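/- Let $\{\mathcal M_n\}$ be an irregular D-GLDPC ensemble sequence, given as follows. There are check node (CN) types $t\in I_c=\{1,\dots,n_c\}$, each with a binary linear local code of length $s_t$ and minimum distance $r_t\ge 2$, and variable node (VN) types $t\in I_v=\{1,\dots,n_v\}$, each with a binary linear local code of length $q_t$, dimension $k_t$ and minimum distance $p_t\ge 2$, together with a full-rank $k_t\times q_t$ generator matrix (encoder); the dual codes of all these local codes have minimum distance greater than one. Fractions $\rho_t>0$ and $\lambda_t>0$ of the edges (rational, $\sum_{t\in I_c}\rho_t=\sum_{t\in I_v}\lambda_t=1$) are connected to CNs, respectively VNs, of type $t$. Let $A^{(t)}_u$ be the number of weight-$u$ codewords of CN type $t$, let $B^{(t)}_{u,v}$ be the number of weight-$u$ input words that the encoder of VN type $t$ maps to a codeword of weight $v$, and let $\int\lambda=\int_0^1\sum_{t\in I_v}\lambda_t x^{q_t-1}\,dx=\sum_{t\in I_v}\lambda_t/q_t$. For a positive integer $n$ put $E=n/\int\lambda$; the ensemble $\mathcal M_n$, which exists if the numbers below are integers, has $E\lambda_t/q_t$ VNs of each type $t\in I_v$ ($n$ VNs in total) and $E\rho_t/s_t$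 CNs of each type $t\in I_c$, and the $E$ VN sockets are connected one-to-one with the $E$ CN sockets by a uniformly random permutation. A codeword is an assignment of values to the local information bits of all VNs such that the bits induced on the edges by local encoding form a valid local codeword at every CN; $A_w$ denotes the number of codewords with $w$ ones. The weight spectral shape is $$G(\alpha)=\lim_{n\to\infty}\frac1n\log\mathbb E_{\mathcal M_n}[A_{\alpha n}],$$ where only those $n$ are included for which $\mathcal M_n$ exists, $\alpha n\in\mathbb Z$ and $\mathbb E_{\mathcal M_n}[A_{\alpha n}]>0$; its domain is the set of those $\alpha>0$ for which there are infinitely many such $n$ (necessarily rational numbers). Let $r=\min_{t\in I_c}r_t$ and $\psi=r/(r-1)$, and let $T$ be the minimum of $(j-\psi)/i$ over all $t\in I_v$ and all pairs $(i,j)\ne(0,0)$ with $B^{(t)}_{i,j}>0$. Let $P_t$ be the set of the pairs $(i,j)$ of type $t$ that achieve this minimum, and $Y_v$ the set of the types $t\in I_v$ with $P_t\ne\emptyset$. Put $$C=r\sum_{t\,:\,r_t=r}\frac{\rho_tA^{(t)}_r}{s_t},$$ $$Q_1(x)=\sum_{t\in Y_v}\frac{\lambda_t}{q_t}\sum_{(i,j)\in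 P_t}j\,B^{(t)}_{i,j}\,C^{j/r}\Big(\frac{\int\lambda}{e}\Big)^{iT/\psi}x^i,\qquad Q_2(x)=\sum_{t\in Y_v}\frac{\lambda_t}{q_t}\sum_{(i,j)\in P_t}i\,B^{(t)}_{i,j}\,C^{j/r}\Big(\frac{\int\lambda}{e}\Big)^{iT/\psi}x^i .$$ Then all sufficiently small positive rational numbers $\alpha$ belong to the domain of $G$ and the limit $G(\alpha)$ exists for them; $C>0$; $Q_1$ is a bijection of $[0,\infty)$ onto itself, with inverse $Q_1^{-1}$; and, as $\alpha\to0^+$ in the domain of $G$, $$G(\alpha)=\frac T\psi\,\alpha\log\alpha+\alpha\left[\log\frac1{Q_1^{-1}(1)}+\frac T\psi\log\frac1{Q_2(Q_1^{-1}(1))}\right]+o(\alpha).$$ -/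

import Mathlib

open Filter Topology Asymptotics

noncomputable section

namespace DGLDPC

/-! ### Local codes -/

/-- Minimum distance of a binary linear code: the least Hamming weight of a nonzero codeword. -/
def minDist {s : ℕ} (C : Submodule (ZMod 2) (Fin s → ZMod 2)) : ℕ :=
  sInf {d | ∃ c ∈ C, c ≠ 0 ∧ hammingNorm c = d}

/-- The dual code has minimum distance greater than one:
no word of weight one is orthogonal to the code. -/
def DualDistGtOne {s : ℕ} (C : Submodule (ZMod 2) (Fin s → ZMod 2)) : Prop :=
  ∀ d : Fin s → ZMod 2, (∀ c ∈ C, d ⬝ᵥ c = 0) → d ≠ 0 → 1 < hammingNorm d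

/-- A check node type: a binary linear block code. -/
structure CheckType where
  /-- length `s` of the local code -/
  len : ℕ
  /-- the local code -/
  code : Submodule (ZMod 2) (Fin len → ZMod 2)
  /-- minimum distance at least two; in particular the code has a nonzero word -/
  two_le_minDist : 2 ≤ minDist code
  dualDist : DualDistGtOne code

/-- `A_u`: the number of local codewords of weight `u`. -/
def CheckType.wefCoeff (c : CheckType) (u : ℕ) : ℕ :=
  Nat.card {w : Fin c.len → ZMod 2 // w ∈ c.code ∧ hammingNorm w = u}

/-- A variable node type: a binary linear block code together with an encoder. -/
structure VarType where
  /-- dimension `k` of the local code -/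
  dim : ℕ
  /-- length `q` of the local code -/
  len : ℕ
  /-- generator matrix -/
  gen : Matrix (Fin dim) (Fin len) (ZMod 2)
  /-- the generator matrix has full row rank -/
  enc_injective : Function.Injective fun u : Fin dim → ZMod 2 => Matrix.vecMul u gen
  two_le_minDist : 2 ≤ minDist (LinearMap.range (Matrix.vecMulLinear gen))
  dualDist : DualDistGtOne (LinearMap.range (Matrix.vecMulLinear gen))

/-- `B_{u,v}`: the number of input words of weight `u` that are encoded
to a local codeword of weight `v`. -/
def VarType.iowefCoeff (c : VarType) (u v : ℕ) : ℕ :=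
  Nat.card {x : Fin c.dim → ZMod 2 //
    hammingNorm x = u ∧ hammingNorm (Matrix.vecMul x c.gen) = v}

/-- The pairs `(i, j)` of the nonconstant monomials `x^i y^j` of the input-output weight
enumerating function. -/
def VarType.monomials (c : VarType) : Finset (ℕ × ℕ) :=
  (Finset.Icc 1 c.dim ×ˢ Finset.Icc 1 c.len).filter fun p => 0 < c.iowefCoeff p.1 p.2

/-! ### The ensemble -/

/-- The parameters of an irregular ensemble with `nc` check node types and `nv` variable node
types. The edge fractions are rational, since the numbers of nodes of each type are integers. -/
structure Params (nc nv : ℕ) where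
  chk : Fin nc → CheckType
  var : Fin nv → VarType
  /-- fraction of edges connected to check nodes of each type -/
  rho : Fin nc → ℚ
  /-- fraction of edges connected to variable nodes of each type -/
  lam : Fin nv → ℚ
  rho_pos : ∀ t, 0 < rho t
  lam_pos : ∀ t, 0 < lam t
  rho_sum : ∑ t, rho t = 1
  lam_sum : ∑ t, lam t = 1

namespace Params

variable {nc nv : ℕ} (P : Params nc nv)

/-- `λ(x) = ∑ λ_t x^(q_t - 1)`. -/
def lamPoly (x : ℝ) : ℝ := ∑ t, (P.lam t : ℝ) * x ^ ((P.var t).len - 1)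

/-- `∫ λ`, in closed form (see `intLam_eq_integral`). -/
def intLam : ℚ := ∑ t, P.lam t / (P.var t).len

/-- The number `E λ_t / q_t` of variable nodes of type `t`, where `E = n / ∫ λ`
(rounded down; only those `n` are used for which it is an integer). -/
def varCount (n : ℕ) (t : Fin nv) : ℕ := ⌊(n / P.intLam) * P.lam t / (P.var t).len⌋₊

/-- The number `E ρ_t / s_t` of check nodes of type `t`, where `E = n / ∫ λ`
(rounded down; only those `n` are used for which it is an integer). -/
def chkCount (n : ℕ) (t : Fin nc) : ℕ := ⌊(n / P.intLam) * P.rho t / (P.chk t).len⌋₊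

/-- The ensemble with `n` variable nodes exists: all the node numbers are integers. -/
def Realizable (n : ℕ) : Prop :=
  0 < n ∧
  (∀ t, (P.varCount n t : ℚ) = (n / P.intLam) * P.lam t / (P.var t).len) ∧
  (∀ t, (P.chkCount n t : ℚ) = (n / P.intLam) * P.rho t / (P.chk t).len)

/-- Variable node sockets: (type, node of this type, position in the local codeword). -/
abbrev VarSocket (n : ℕ) : Type := Σ t : Fin nv, Fin (P.varCount n t) × Fin (P.var t).len

/-- Check node sockets: (type, node of this type, position in the local codeword). -/
abbrev ChkSocket (n : ℕ) : Type := Σ t : Fin nc, Fin (P.chkCount n t) × Fin (P.chk t).len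

/-- A code of the ensemble: a one-to-one connection of the variable node sockets with
the check node sockets. For a realizable `n` there are `E!` of them. -/
abbrev Wiring (n : ℕ) : Type := P.VarSocket n ≃ P.ChkSocket n

/-- An assignment of values to the local information bits of all variable nodes. -/
abbrev Word (n : ℕ) : Type :=
  ∀ t : Fin nv, Fin (P.varCount n t) → Fin (P.var t).dim → ZMod 2

variable {P}

/-- The bit induced on a variable node socket through local encoding. -/
def edgeBit {n : ℕ} (x : P.Word n) (e : P.VarSocket n) : ZMod 2 :=
  Matrix.vecMul (x e.1 e.2.1) (P.var e.1).gen e.2.2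

/-- `x` is a codeword of the code given by `σ`: every check node sees a local codeword. -/
def IsCodeword {n : ℕ} (σ : P.Wiring n) (x : P.Word n) : Prop :=
  ∀ (t : Fin nc) (b : Fin (P.chkCount n t)),
    (fun j => edgeBit x (σ.symm ⟨t, b, j⟩)) ∈ (P.chk t).code

/-- The Hamming weight of an assignment. -/
def weight {n : ℕ} (x : P.Word n) : ℕ := ∑ t, ∑ a, hammingNorm (x t a)

/-- `A_w`: the number of codewords of weight `w`. -/
def numCodewords {n : ℕ} (σ : P.Wiring n) (w : ℕ) : ℕ :=
  Nat.card {x : P.Word n // IsCodeword σ x ∧ weight x = w}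

variable (P)

/-- The expectation of `A_w` under the uniform distribution on all socket permutations. -/
def expCodewords (n w : ℕ) : ℝ :=
  (∑ σ : P.Wiring n, (numCodewords σ w : ℝ)) / Fintype.card (P.Wiring n)

/-- The positive integers `n` over which the limit that defines the spectral shape at `α` is
taken: the ensemble exists, `α n` is an integer, and `𝔼[A_{α n}]` is positive. -/
def Admissible (α : ℝ) (n : ℕ) : Prop :=
  P.Realizable n ∧ (∃ w : ℕ, (w : ℝ) = α * n) ∧ 0 < P.expCodewords n ⌊α * n⌋₊

/-- The filter `n → ∞` over the admissible `n`. -/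
def admissibleFilter (α : ℝ) : Filter ℕ := atTop ⊓ 𝓟 {n | P.Admissible α n}

/-- `(1/n) log 𝔼[A_{α n}]`. -/
def normLogExp (α : ℝ) (n : ℕ) : ℝ := (1 / n : ℝ) * Real.log (P.expCodewords n ⌊α * n⌋₊)

/-- The weight spectral shape `G(α)`. -/
def spectralShape (α : ℝ) : ℝ := limUnder (P.admissibleFilter α) (P.normLogExp α)

/-- The arguments `α > 0` at which the limit defining `G(α)` runs over infinitely many `n`. -/
def spectralDomain : Set ℝ := {α | 0 < α ∧ ∃ᶠ n in atTop, P.Admissible α n}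

/-! ### The parameters of the expansion -/

/-- `r`: the smallest minimum distance over all check node types. -/
def r : ℕ := ⨅ t, minDist (P.chk t).code

/-- `ψ = r / (r - 1)`. -/
def psi : ℝ := (P.r : ℝ) / ((P.r : ℝ) - 1)

/-- `T`: the minimum of `(j - ψ) / i` over all variable node types and all monomials. -/
def T : ℝ := sInf {x | ∃ t, ∃ p ∈ (P.var t).monomials, x = ((p.2 : ℝ) - P.psi) / (p.1 : ℝ)}

open Classical in
/-- `P_t`: the pairs `(i, j)` for which the minimum `T` is achieved. -/
def minPairs (t : Fin nv) : Finset (ℕ × ℕ) :=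
  (P.var t).monomials.filter fun p => ((p.2 : ℝ) - P.psi) / (p.1 : ℝ) = P.T

open Classical in
/-- `Y_v`: the variable node types for which the minimum `T` is achieved. -/
def minTypes : Finset (Fin nv) := Finset.univ.filter fun t => (P.minPairs t).Nonempty

/-- `C = r ∑_{t : r_t = r} ρ_t A_r^(t) / s_t`. -/
def C : ℝ :=
  P.r * ∑ t with minDist (P.chk t).code = P.r,
    (P.rho t : ℝ) * (P.chk t).wefCoeff P.r / (P.chk t).len

/-- The polynomial `Q₁`. -/
def Q1 (x : ℝ) : ℝ :=
  ∑ t ∈ P.minTypes, (P.lam t : ℝ) / (P.var t).len *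
    ∑ p ∈ P.minPairs t, (p.2 : ℝ) * (P.var t).iowefCoeff p.1 p.2 *
      P.C ^ ((p.2 : ℝ) / P.r) *
      ((P.intLam : ℝ) / Real.exp 1) ^ ((p.1 : ℝ) * P.T / P.psi) * x ^ p.1

/-- The polynomial `Q₂`. -/
def Q2 (x : ℝ) : ℝ :=
  ∑ t ∈ P.minTypes, (P.lam t : ℝ) / (P.var t).len *
    ∑ p ∈ P.minPairs t, (p.1 : ℝ) * (P.var t).iowefCoeff p.1 p.2 *
      P.C ^ ((p.2 : ℝ) / P.r) *
      ((P.intLam : ℝ) / Real.exp 1) ^ ((p.1 : ℝ) * P.T / P.psi) * x ^ p.1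

/-- `Q₁⁻¹`: the inverse of `Q₁` on the nonnegative reals. -/
def Q1inv : ℝ → ℝ := Function.invFunOn P.Q1 (Set.Ici 0)

/-- `intLam` is the integral of `λ(x)` over `[0, 1]`. -/
theorem intLam_eq_integral : (P.intLam : ℝ) = ∫ x in (0 : ℝ)..1, P.lamPoly x := by
  have hlen : ∀ t, (P.var t).len ≠ 0 := by
    intro t h0
    have h2 := (P.var t).two_le_minDist
    obtain ⟨c, -, hc, -⟩ := Nat.sInf_mem (Nat.nonempty_of_pos_sInf (lt_of_lt_of_le two_pos h2))
    apply hc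
    funext i
    exact absurd i.isLt (by omega)
  unfold lamPoly intLam
  rw [intervalIntegral.integral_finsetSum]
  · push_cast
    refine Finset.sum_congr rfl fun t _ => ?_
    rw [intervalIntegral.integral_const_mul, integral_pow]
    have h1 : (((P.var t).len - 1 : ℕ) : ℝ) + 1 = (P.var t).len := by
      have := hlen t
      exact_mod_cast Nat.sub_add_cancel (Nat.pos_of_ne_zero this)
    rw [h1]
    simp [div_eq_mul_inv]
  · intro t _
    apply Continuous.intervalIntegrable
    fun_prop

end Params

end DGLDPC

end

/-! A uniformly random wiring maps a word with `d` ones on the edges to a uniformly distributed word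
of weight `d`. Hence `𝔼[A_w]` is a sum over `d` of (variable configurations with weights `(w, d)`) ×
(check configurations of weight `d`) / `E.choose d` (`expCodewords_eq_sum`). There are only `E + 1`
summands, so the largest one decides the growth rate.

Configurations can be concatenated, so a Fekete-type argument applies (`spectralShape_spec`): the
limit exists and dominates the rate of every single summand, after a correction of order `log E` for
the binomial coefficient. For the lower bound it then suffices to exhibit good summands along one
sequence of lengths.

Upper bound (`log_expTerm_le`): put `δ = d / E`, and use Chernoff bounds with parameters `x, y` for
variable nodes and `z` for check nodes, where `z` is the leading-order optimum and `y * z = δ`, so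
that the `δ log δ` terms cancel. A monomial `x^i y^j` becomes a constant times `δ^((j - iT)/ψ)`. By
minimality of `T` the exponent is at least one, with equality exactly on the minimal pairs; all else
is `o(δ)`. At `x₀ = Q1inv 1` the terms linear in `δ` add up to `-(T/ψ) Q₂(x₀) δ`, and `log t ≤ t -
1` bounds the remaining function of `δ` by its value at the maximizer. As `d` is at most a constant
times `w`, the errors are `o(α)` uniformly in `d`.

Lower bound (`exists_le_log_expTerm`): only local words with minimal weight pairs, in proportions `s
* θ p`, and check codewords of weight `r` are used, and the configurations are counted by
multinomial coefficients. The resulting rate is exactly the expansion plus `s * lowerGap θ`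
(`lowerRate_eq`), up to `O(s ^ 2)`. The gap vanishes at `θ = minTerm x₀`; rational `θ` close to it
keep all node counts integral. -/

noncomputable section

namespace DGLDPC

/-! ### Configurations of independent nodes -/

section Config

variable {ι : Type} [Fintype ι] {X : ι → Type} {M : Type} [AddCommMonoid M]

/-- The number of ways to choose a local state for each of `m t` nodes of every type `t` such that
the local weights add up to `s`. -/
def configCount (u : ∀ t, X t → M) (m : ι → ℕ) (s : M) : ℕ :=
  Nat.card {ω : ∀ t, Fin (m t) → X t // ∑ t, ∑ a, u t (ω t a) = s}

theorem configCount_zero (u : ∀ t, X t → M) : configCount u 0 0 = 1 := by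
  unfold configCount
  rw [Nat.card_eq_one_iff_unique]
  constructor
  · constructor
    rintro ⟨a, _⟩ ⟨b, _⟩
    congr
    funext t i
    exact i.elim0
  · exact ⟨fun t i => Fin.elim0 i, by simp⟩

variable [∀ t, Fintype (X t)]

/-- Appending the states type by type is injective, and both node numbers and total weights add.
This is the source of supermultiplicativity. -/
theorem configCount_mul_le (u : ∀ t, X t → M) (m m' : ι → ℕ) (s s' : M) :
    configCount u m s * configCount u m' s' ≤ configCount u (m + m') (s + s') := by
  unfold configCount
  rw [← Nat.card_prod]
  refine Nat.card_le_card_of_injective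
    (fun p => ⟨fun t => Fin.append (p.1.1 t) (p.2.1 t), ?_⟩) ?_
  · refine Eq.trans ?_ (congrArg₂ (· + ·) p.1.2 p.2.2)
    simp only [← Finset.sum_add_distrib]
    refine Finset.sum_congr rfl fun t _ => ?_
    have := Fin.sum_univ_add (fun a => u t (Fin.append (p.1.1 t) (p.2.1 t) a))
    simpa using this
  · rintro ⟨⟨a, ha⟩, b, hb⟩ ⟨⟨a', ha'⟩, b', hb'⟩ h
    simp only [Subtype.mk.injEq, Prod.mk.injEq] at h ⊢
    constructor
    · funext t i
      have := congrFun (congrFun h t) (Fin.castAdd _ i)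
      simpa using this
    · funext t i
      have := congrFun (congrFun h t) (Fin.natAdd _ i)
      simpa using this

theorem pow_configCount_le (u : ∀ t, X t → M) (m : ι → ℕ) (s : M) (k : ℕ) :
    configCount u m s ^ k ≤ configCount u (k • m) (k • s) := by
  induction k with
  | zero => simp [configCount_zero]
  | succ k ih =>
    rw [pow_succ, succ_nsmul, succ_nsmul]
    exact (Nat.mul_le_mul_right _ ih).trans (configCount_mul_le u _ _ _ _)

/-- The Chernoff bound for the number of configurations. -/
theorem configCount_mul_le_prod (u : ∀ t, X t → M) (m : ι → ℕ) (s : M)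
    (φ : Multiplicative M →* ℝ) (hφ : ∀ a, 0 ≤ φ a) :
    (configCount u m s : ℝ) * φ (.ofAdd s) ≤ ∏ t, (∑ x, φ (.ofAdd (u t x))) ^ m t := by
  classical
  -- Expanding the product yields one term per configuration, equal to `φ` of its total weight.
  -- Keeping only the configurations of total weight `s` gives the bound.
  have h1 : ∏ t, (∑ x, φ (.ofAdd (u t x))) ^ m t
      = ∑ ω : ∀ t, Fin (m t) → X t, φ (.ofAdd (∑ t, ∑ a, u t (ω t a))) := by
    have : ∀ t, (∑ x, φ (.ofAdd (u t x))) ^ m t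
        = ∑ f : Fin (m t) → X t, ∏ a, φ (.ofAdd (u t (f a))) := by
      intro t
      have := Finset.prod_univ_sum (fun _ : Fin (m t) => (Finset.univ : Finset (X t)))
        (fun _ x => φ (.ofAdd (u t x)))
      simpa [Fintype.piFinset_univ] using this
    simp_rw [this]
    have := Finset.prod_univ_sum (fun t => (Finset.univ : Finset (Fin (m t) → X t)))
        (fun t f => ∏ a, φ (.ofAdd (u t (f a))))
    rw [this, Fintype.piFinset_univ]
    refine Finset.sum_congr rfl fun ω _ => ?_
    simp only [ofAdd_sum, map_prod]
  rw [h1, configCount, Nat.card_eq_fintype_card, Fintype.card_subtype, ← nsmul_eq_mul,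
    ← Finset.sum_const]
  calc _ = ∑ ω : ∀ t, Fin (m t) → X t with ∑ t, ∑ a, u t (ω t a) = s,
        φ (.ofAdd (∑ t, ∑ a, u t (ω t a))) :=
        Finset.sum_congr rfl fun ω hω => by rw [(Finset.mem_filter.1 hω).2]
    _ ≤ _ := Finset.sum_le_sum_of_subset_of_nonneg (Finset.filter_subset _ _)
        fun _ _ _ => hφ _

/-- The words with prescribed letter counts are counted by multinomial coefficients. -/
theorem card_letterCounts {Y : Type} [Fintype Y] [DecidableEq Y] (c : Y → ℕ) :
    Fintype.card {f : Fin (∑ y, c y) → Y // ∀ y, Fintype.card {a // f a = y} = c y}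
      = Nat.multinomial Finset.univ c := by
  set N := ∑ y, c y
  -- The power `(∑ X_y)^N` is expanded in two ways, by the multinomial theorem and as a sum over all
  -- words; the coefficients of one monomial are then compared.
  have h := Finset.sum_pow_eq_sum_piAntidiag (Finset.univ : Finset Y)
    (fun y => (MvPolynomial.X y : MvPolynomial Y ℕ)) N
  have h2 := Finset.prod_univ_sum (fun _ : Fin N => (Finset.univ : Finset Y))
        (fun _ y => (MvPolynomial.X y : MvPolynomial Y ℕ))
  simp only [Finset.prod_const, Finset.card_univ, Fintype.card_fin, Fintype.piFinset_univ] at h2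
  rw [h2] at h
  have h3 : ∀ f : Fin N → Y, ∏ a, (MvPolynomial.X (f a) : MvPolynomial Y ℕ)
      = MvPolynomial.monomial (Finsupp.equivFunOnFinite.symm
          fun y => Fintype.card {a // f a = y}) 1 := by
    intro f
    rw [MvPolynomial.monomial_eq, Finsupp.prod_fintype _ _ (by simp)]
    simp only [map_one, one_mul, Finsupp.equivFunOnFinite_symm_apply_apply]
    rw [← Finset.prod_fiberwise Finset.univ f]
    refine Finset.prod_congr rfl fun y _ => ?_
    rw [Finset.prod_congr rfl (g := fun _ => MvPolynomial.X y)
      (fun a ha => by rw [(Finset.mem_filter.1 ha).2]), Finset.prod_const, Fintype.card_subtype]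
  have h4 : ∀ k : Y → ℕ, ∏ y, (MvPolynomial.X y : MvPolynomial Y ℕ) ^ k y
      = MvPolynomial.monomial (Finsupp.equivFunOnFinite.symm k) 1 := by
    intro f
    rw [MvPolynomial.monomial_eq, Finsupp.prod_fintype _ _ (by simp)]
    simp
  simp_rw [h3, h4] at h
  have h5 := congrArg (MvPolynomial.coeff (Finsupp.equivFunOnFinite.symm c)) h
  simp only [MvPolynomial.coeff_sum, MvPolynomial.coeff_monomial,
    EmbeddingLike.apply_eq_iff_eq, ← MvPolynomial.C_eq_coe_nat, MvPolynomial.coeff_C_mul] at h5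
  rw [Finset.sum_boole, Fintype.card_subtype] at *
  simp only [mul_ite, mul_one, mul_zero, Finset.sum_ite_eq', Finset.mem_piAntidiag] at h5
  rw [if_pos ⟨rfl, by simp⟩] at h5
  simp only [funext_iff] at h5
  exact_mod_cast h5

/-- The method of types: only those configurations are counted in which every state `x` of type `t`
occurs exactly `c t x` times. -/
theorem prod_multinomial_le_configCount (u : ∀ t, X t → M) (m : ι → ℕ) (s : M)
    (c : ∀ t, X t → ℕ) (hm : ∀ t, ∑ x, c t x = m t) (hs : ∑ t, ∑ x, c t x • u t x = s) :
    ∏ t, Nat.multinomial Finset.univ (c t) ≤ configCount u m s := by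
  classical
  obtain rfl : (fun t => ∑ x, c t x) = m := funext hm
  simp_rw [← card_letterCounts]
  rw [← Fintype.card_pi, configCount, Nat.card_eq_fintype_card]
  refine Fintype.card_le_of_injective (fun ω => ⟨fun t => (ω t).1, ?_⟩) ?_
  · rw [← hs]
    refine Finset.sum_congr rfl fun t _ => ?_
    rw [← Finset.sum_fiberwise Finset.univ (ω t).1]
    refine Finset.sum_congr rfl fun x _ => ?_
    rw [Finset.sum_congr rfl (g := fun _ => u t x)
      (fun a ha => by
        rw [← (Finset.mem_filter.1 ha).2]), Finset.sum_const, ← (ω t).2 x,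
      Fintype.card_subtype]
  · intro a b h
    funext t
    simp only [Subtype.mk.injEq] at h
    exact Subtype.ext (congrFun h t)

end Config

/-! ### Words under a uniformly random bijection of their positions -/

section RandomWiring

variable {A B : Type} [Fintype A] [Fintype B]

theorem hammingNorm_comp_symm (y : A → ZMod 2) (σ : A ≃ B) :
    hammingNorm (y ∘ σ.symm) = hammingNorm y := by
  simp only [hammingNorm]
  exact Finset.card_bij' (fun b _ => σ.symm b) (fun a _ => σ a) (by simp) (by simp) (by simp)
    (by simp)

theorem exists_perm_comp_eq {v v' : B → ZMod 2} (h : hammingNorm v = hammingNorm v') :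
    ∃ π : Equiv.Perm B, v' ∘ π = v := by
  have hc : Fintype.card {b // v b ≠ 0} = Fintype.card {b // v' b ≠ 0} := by
    simpa only [Fintype.card_subtype, hammingNorm] using h
  have h01 : ∀ a b : ZMod 2, (a ≠ 0 ↔ b ≠ 0) → a = b := by decide
  let e := Fintype.equivOfCardEq hc
  refine ⟨e.extendSubtype, funext fun b => h01 _ _ ?_⟩
  by_cases hb : v b ≠ 0
  · exact iff_of_true (e.extendSubtype_mem b hb) hb
  · exact iff_of_false (e.extendSubtype_not_mem b hb) hb

variable [DecidableEq B]

theorem card_hammingNorm_eq (d : ℕ) :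
    ({v : B → ZMod 2 | hammingNorm v = d} : Finset _).card = (Fintype.card B).choose d := by
  rw [← Finset.card_univ, ← Finset.card_powersetCard]
  have h01 : ∀ a b : ZMod 2, (a ≠ 0 ↔ b ≠ 0) → a = b := by decide
  refine Finset.card_bij' (fun v _ => ({b | v b ≠ 0} : Finset B))
    (fun s _ b => if b ∈ s then 1 else 0) ?_ ?_ ?_ ?_
  · intro v hv
    simpa [Finset.mem_powersetCard, hammingNorm] using hv
  · intro s hs
    simpa [Finset.mem_powersetCard, hammingNorm] using hs
  · intro v hv
    funext b
    apply h01
    by_cases hb : v b = 0 <;> simp [hb]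
  · intro s hs
    ext b
    simp

variable [DecidableEq A]

/-- Binary words of equal weight differ by a permutation of positions, and composing wirings with it
is a bijection. Thus the image of a fixed word under a random wiring is uniform on its weight class.
-/
theorem card_wirings_comp_eq (y : A → ZMod 2) {v v' : B → ZMod 2}
    (h : hammingNorm v = hammingNorm v') :
    ({σ : A ≃ B | y ∘ σ.symm = v} : Finset _).card
      = ({σ : A ≃ B | y ∘ σ.symm = v'} : Finset _).card := by
  obtain ⟨π, hπ⟩ := exists_perm_comp_eq h
  refine Finset.card_bij' (fun σ _ => σ.trans π) (fun σ _ => σ.trans π.symm) ?_ ?_ ?_ ?_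
  · intro σ hσ
    simp only [Finset.mem_filter, Finset.mem_univ, true_and] at hσ ⊢
    funext b
    have := congrFun hσ (π.symm b)
    rw [← hπ] at this
    simpa using this
  · intro σ hσ
    simp only [Finset.mem_filter, Finset.mem_univ, true_and] at hσ ⊢
    funext b
    have := congrFun hσ (π b)
    rw [← hπ]
    simpa using this
  · intro σ _; ext; simp
  · intro σ _; ext; simp

theorem card_wirings_comp_mul_choose {y : A → ZMod 2} {v : B → ZMod 2}
    (h : hammingNorm v = hammingNorm y) :
    ({σ : A ≃ B | y ∘ σ.symm = v} : Finset _).card * (Fintype.card B).choose (hammingNorm y)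
      = Fintype.card (A ≃ B) := by
  rw [← card_hammingNorm_eq, mul_comm, ← smul_eq_mul, ← Finset.sum_const,
    ← Finset.card_univ (α := A ≃ B), eq_comm,
    Finset.card_eq_sum_card_fiberwise (f := fun σ : A ≃ B => y ∘ σ.symm)
      (t := ({v : B → ZMod 2 | hammingNorm v = hammingNorm y} : Finset _))]
  · refine Finset.sum_congr rfl fun v' hv' => ?_
    exact card_wirings_comp_eq y ((Finset.mem_filter.1 hv').2.trans h.symm)
  · intro σ _
    simp [hammingNorm_comp_symm]

theorem card_wirings_mem (hAB : Fintype.card A = Fintype.card B) (y : A → ZMod 2)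
    (V : Finset (B → ZMod 2)) :
    (({σ : A ≃ B | y ∘ σ.symm ∈ V} : Finset _).card : ℝ) / Fintype.card (A ≃ B)
      = ({v ∈ V | hammingNorm v = hammingNorm y} : Finset _).card /
        (Fintype.card B).choose (hammingNorm y) := by
  have hd : hammingNorm y ≤ Fintype.card B := hAB ▸ hammingNorm_le_card_fintype
  have h1 : ({σ : A ≃ B | y ∘ σ.symm ∈ V} : Finset _).card *
      (Fintype.card B).choose (hammingNorm y)
      = ({v ∈ V | hammingNorm v = hammingNorm y} : Finset _).card * Fintype.card (A ≃ B) := by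
    rw [Finset.card_eq_sum_card_fiberwise (f := fun σ : A ≃ B => y ∘ σ.symm)
      (t := ({v ∈ V | hammingNorm v = hammingNorm y} : Finset _)), Finset.sum_mul,
      ← smul_eq_mul ({v ∈ V | hammingNorm v = hammingNorm y} : Finset _).card, ← Finset.sum_const]
    · refine Finset.sum_congr rfl fun v hv => ?_
      rw [← card_wirings_comp_mul_choose (Finset.mem_filter.1 hv).2]
      congr 2
      ext σ
      simp only [Finset.mem_filter, Finset.mem_univ, true_and, and_iff_right_iff_imp]
      rintro rfl
      exact (Finset.mem_filter.1 hv).1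
    · intro σ hσ
      simpa [hammingNorm_comp_symm] using hσ
  have h2 : ((Fintype.card B).choose (hammingNorm y) : ℝ) ≠ 0 := by
    exact_mod_cast (Nat.choose_pos hd).ne'
  have h3 : (Fintype.card (A ≃ B) : ℝ) ≠ 0 := by
    have : Nonempty (A ≃ B) := ⟨Fintype.equivOfCardEq hAB⟩
    exact_mod_cast Fintype.card_ne_zero
  rw [div_eq_div_iff h3 h2]
  exact_mod_cast h1

end RandomWiring

/-! ### The expected number of codewords -/

instance (c : CheckType) : Fintype c.code := Fintype.ofFinite _

namespace Params

variable {nc nv : ℕ} (P : Params nc nv)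

/-- Input weight and output weight of a local word of a variable node. -/
def varWeight (t : Fin nv) (x : Fin (P.var t).dim → ZMod 2) : ℕ × ℕ :=
  (hammingNorm x, hammingNorm (Matrix.vecMul x (P.var t).gen))

/-- The weight of a local codeword of a check node. -/
def chkWeight (t : Fin nc) (c : (P.chk t).code) : ℕ := hammingNorm c.1

/-- The number of edges. -/
def edgeCount (n : ℕ) : ℕ := ∑ t, P.chkCount n t * (P.chk t).len

/-- The expected number of codewords of weight `w` that induce `d` ones on the edges. -/
def expTerm (n w d : ℕ) : ℝ :=
  (configCount P.varWeight (P.varCount n) (w, d) : ℝ) *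
    configCount P.chkWeight (P.chkCount n) d / (P.edgeCount n).choose d

variable {P}

theorem hammingNorm_edgeBit {n : ℕ} (x : P.Word n) :
    hammingNorm (edgeBit x) = ∑ t, ∑ a, hammingNorm (Matrix.vecMul (x t a) (P.var t).gen) := by
  simp only [hammingNorm, Finset.card_filter]
  rw [Fintype.sum_sigma]
  refine Finset.sum_congr rfl fun t _ => ?_
  rw [Fintype.sum_prod_type]
  rfl

theorem sum_varWeight {n : ℕ} (x : P.Word n) :
    ∑ t, ∑ a, P.varWeight t (x t a) = (weight x, hammingNorm (edgeBit x)) := by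
  rw [hammingNorm_edgeBit]
  ext <;> simp [varWeight, weight, Prod.fst_sum, Prod.snd_sum]

variable (P)

theorem card_chkSocket (n : ℕ) : Fintype.card (P.ChkSocket n) = P.edgeCount n := by
  simp [ChkSocket, edgeCount]

theorem card_checkWords_eq (n d : ℕ) [DecidablePred fun v : P.ChkSocket n → ZMod 2 =>
      (∀ t b, (fun j => v ⟨t, b, j⟩) ∈ (P.chk t).code)] :
    (({v | ∀ t b, (fun j => v ⟨t, b, j⟩) ∈ (P.chk t).code} :
      Finset (P.ChkSocket n → ZMod 2)).filter fun v => hammingNorm v = d).card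
      = configCount P.chkWeight (P.chkCount n) d := by
  classical
  rw [Finset.filter_filter, configCount, Nat.card_eq_fintype_card, Fintype.card_subtype]
  have hw : ∀ v : P.ChkSocket n → ZMod 2,
      hammingNorm v = ∑ t, ∑ b, hammingNorm fun j => v ⟨t, b, j⟩ := by
    intro v
    simp only [hammingNorm, Finset.card_filter]
    rw [Fintype.sum_sigma]
    refine Finset.sum_congr rfl fun t _ => ?_
    rw [Fintype.sum_prod_type]
  refine Finset.card_bij'
    (fun v hv t b => ⟨fun j => v ⟨t, b, j⟩, (Finset.mem_filter.1 hv).2.1 t b⟩)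
    (fun ω _ e => (ω e.1 e.2.1).1 e.2.2) ?_ ?_ ?_ ?_
  · intro v hv
    simp only [Finset.mem_filter, Finset.mem_univ, true_and] at hv ⊢
    exact (hw v).symm.trans hv.2
  · intro ω hω
    simp only [Finset.mem_filter, Finset.mem_univ, true_and] at hω ⊢
    refine ⟨fun t b => (ω t b).2, ?_⟩
    rw [hw, ← hω]
    rfl
  · intro v _; rfl
  · intro ω _; rfl

/-- Linearity of expectation over the words `x`: the probability that `x` is a codeword depends only
on the number `d` of ones that it induces, so the words are grouped by `d`. -/
theorem expCodewords_eq_sum (n w : ℕ)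
    (hE : Fintype.card (P.VarSocket n) = Fintype.card (P.ChkSocket n)) :
    P.expCodewords n w = ∑ d ∈ Finset.range (P.edgeCount n + 1), P.expTerm n w d := by
  classical
  let V : Finset (P.ChkSocket n → ZMod 2) := {v | ∀ t b, (fun j => v ⟨t, b, j⟩) ∈ (P.chk t).code}
  have hV : ∀ (σ : P.Wiring n) (x : P.Word n), IsCodeword σ x ↔ edgeBit x ∘ σ.symm ∈ V := by
    intro σ x
    simp [V, IsCodeword]
  have h1 : (∑ σ : P.Wiring n, (numCodewords σ w : ℝ))
      = ∑ x : P.Word n with weight x = w,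
        (({σ : P.Wiring n | edgeBit x ∘ σ.symm ∈ V} : Finset _).card : ℝ) := by
    have hσ : ∀ σ : P.Wiring n, (numCodewords σ w : ℝ)
        = ∑ x : P.Word n with weight x = w, if edgeBit x ∘ σ.symm ∈ V then 1 else 0 := by
      intro σ
      rw [numCodewords, Nat.card_eq_fintype_card, Fintype.card_subtype, Finset.sum_boole,
        Finset.filter_filter]
      congr 3
      ext x
      rw [hV, and_comm]
    simp_rw [hσ]
    rw [Finset.sum_comm]
    refine Finset.sum_congr rfl fun x _ => ?_
    rw [Finset.sum_boole]
  rw [expCodewords, h1, Finset.sum_div]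
  simp_rw [card_wirings_mem hE]
  rw [← Finset.sum_fiberwise_of_maps_to (g := fun x : P.Word n => hammingNorm (edgeBit x))
    (t := Finset.range (P.edgeCount n + 1))]
  · refine Finset.sum_congr rfl fun d _ => ?_
    rw [Finset.sum_congr rfl (g := fun _ =>
      (configCount P.chkWeight (P.chkCount n) d : ℝ) / (P.edgeCount n).choose d)]
    · rw [Finset.sum_const, nsmul_eq_mul, expTerm, mul_div_assoc]
      congr 2
      rw [Finset.filter_filter, configCount, Nat.card_eq_fintype_card, Fintype.card_subtype]
      congr 1
      ext x
      have := sum_varWeight x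
      simp only [Finset.mem_filter, Finset.mem_univ, true_and]
      rw [this, Prod.mk.injEq]
    · intro x hx
      rw [(Finset.mem_filter.1 hx).2, card_chkSocket]
      congr 2
      exact P.card_checkWords_eq n d
  · intro x _
    rw [Finset.mem_range, Nat.lt_succ_iff, ← card_chkSocket, ← hE]
    exact hammingNorm_le_card_fintype

end Params

/-! ### Estimates for factorials, binomial and multinomial coefficients -/

open Real in
-- A weak form of Stirling's formula. An error of order `log c` is harmless, since every such term
-- is eventually divided by `n`.
theorem log_factorial_le (c : ℕ) :
    log c.factorial ≤ c * log c - c + log c + 1 := by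
  induction c with
  | zero => simp
  | succ c ih =>
    rcases Nat.eq_zero_or_pos c with rfl | hc
    · simp
    have hc' : (0 : ℝ) < c := by exact_mod_cast hc
    rw [Nat.factorial_succ]
    push_cast
    rw [log_mul (by positivity) (by positivity)]
    have h1 : 1 - (((c : ℝ) + 1) / c)⁻¹ ≤ log (((c : ℝ) + 1) / c) :=
      one_sub_inv_le_log_of_pos (by positivity)
    rw [log_div (by positivity) (by positivity), inv_div] at h1
    have h2 : ((c : ℝ) + 1) * (1 - c / (c + 1)) = 1 := by field_simp; ring
    have h3 := mul_le_mul_of_nonneg_left h1 (by positivity : (0 : ℝ) ≤ c + 1)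
    nlinarith

open Real in
theorem le_log_factorial (c : ℕ) : c * log c - c ≤ log c.factorial := by
  rcases Nat.eq_zero_or_pos c with rfl | hc
  · simp
  have hc' : (0 : ℝ) < c := by exact_mod_cast hc
  have h := pow_div_factorial_le_exp (x := c) hc'.le c
  have := log_le_log (by positivity) h
  rw [log_exp, log_div (by positivity) (by positivity), log_pow] at this
  linarith

theorem log_natCast_le {a b : ℕ} (h : a ≤ b) : Real.log a ≤ Real.log b := by
  rcases Nat.eq_zero_or_pos a with rfl | ha
  · simpa using Real.log_natCast_nonneg b
  · exact Real.log_le_log (by exact_mod_cast ha) (by exact_mod_cast h)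

open Real in
theorem le_log_choose {E d : ℕ} (h : d ≤ E) :
    E * log E - d * log d - (E - d : ℝ) * log (E - d) - 2 * log E - 2 ≤ log (E.choose d) := by
  have h1 : ((E.choose d : ℕ) : ℝ) * d.factorial * (E - d).factorial = E.factorial := by
    exact_mod_cast Nat.choose_mul_factorial_mul_factorial h
  have h0 : (0 : ℝ) < E.choose d := by exact_mod_cast Nat.choose_pos h
  have h2 := congrArg log h1
  rw [log_mul (by positivity) (by positivity), log_mul (by positivity) (by positivity)] at h2
  have h3 := le_log_factorial E
  have h4 := log_factorial_le d
  have h5 := log_factorial_le (E - d)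
  have h6 := log_natCast_le h
  have h7 := log_natCast_le (Nat.sub_le E d)
  push_cast [h] at h5 h7
  linarith

open Real in
theorem le_log_choose_of_lt {E d : ℕ} (h : d < E) (hd : 0 < d) :
    -d * log (d / E) - (E - d : ℝ) * log (1 - d / E) - 2 * log E - 2 ≤ log (E.choose d) := by
  have h1 := le_log_choose h.le
  have hd' : (0 : ℝ) < d := by exact_mod_cast hd
  have hE' : (0 : ℝ) < E := by exact_mod_cast (hd.trans h)
  have hlt : (d : ℝ) < E := by exact_mod_cast h
  have h2 : 1 - (d : ℝ) / E = (E - d) / E := by field_simp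
  rw [h2, log_div (sub_pos.2 hlt).ne' hE'.ne', log_div hd'.ne' hE'.ne']
  linarith

open Real in
-- The entropy is reduced to `δ (1 - log δ)`; the loss `δ ^ 2` comes from `log (1 - δ) ≤ -δ`.
theorem le_log_choose_quadratic {E d : ℕ} (h : d < E) (hd : 0 < d) {δ : ℝ} (hδ : (d : ℝ) = E * δ) :
    E * (-δ * log δ + δ - δ ^ 2) - 2 * log E - 2 ≤ log (E.choose d) := by
  have h1 := le_log_choose_of_lt h hd
  have hE' : (0 : ℝ) < E := by exact_mod_cast (hd.trans h)
  have hlt : (d : ℝ) < E := by exact_mod_cast h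
  have h3 : (d : ℝ) / E = δ := by rw [hδ]; field_simp
  rw [h3] at h1
  have hδ1 : δ < 1 := by rw [← h3, div_lt_one hE']; exact hlt
  have h4 : log (1 - δ) ≤ -δ := by have := log_le_sub_one_of_pos (x := 1 - δ) (by linarith); linarith
  have h5 := mul_le_mul_of_nonneg_left h4 (by linarith : (0 : ℝ) ≤ E - d)
  rw [hδ] at h1 h5
  nlinarith

open Real in
-- A single term of `(x + (1 - x))^E = 1`. With `x` fixed the bound is linear in `d` and `E`, hence
-- additive under concatenation.
theorem log_choose_le {E d : ℕ} (h : d ≤ E) {x : ℝ} (hx : 0 < x) (hx1 : x < 1) :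
    log (E.choose d) ≤ -d * log x - (E - d : ℝ) * log (1 - x) := by
  have h0 : (0 : ℝ) < E.choose d := by exact_mod_cast Nat.choose_pos h
  have hx1' : 0 < 1 - x := by linarith
  have h1 : x ^ d * (1 - x) ^ (E - d) * E.choose d ≤ 1 := by
    have h2 := add_pow x (1 - x) E
    rw [add_sub_cancel, one_pow] at h2
    exact (Finset.single_le_sum (f := fun m => x ^ m * (1 - x) ^ (E - m) * E.choose m)
      (fun i _ => by positivity) (Finset.mem_range.2 (Nat.lt_succ_of_le h))).trans h2.ge
  have h3 := log_le_log (by positivity) h1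
  rw [log_one, log_mul (by positivity) (by positivity), log_mul (by positivity) (by positivity),
    log_pow, log_pow, Nat.cast_sub h] at h3
  linarith

open Real in
theorem log_choose_le_linear {E d : ℕ} (h : d ≤ E) (hd : 0 < d) {δ : ℝ} (hδ : (d : ℝ) = E * δ) :
    log (E.choose d) ≤ E * (δ * (1 - log δ)) := by
  have hd' : (0 : ℝ) < d := by exact_mod_cast hd
  have hE' : (0 : ℝ) < E := by exact_mod_cast (hd.trans_le h)
  have h0 : (0 : ℝ) < E.choose d := by exact_mod_cast Nat.choose_pos h
  have h1 : ((E.choose d : ℕ) : ℝ) ≤ E ^ d / d.factorial := Nat.choose_le_pow_div d E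
  have h2 := log_le_log h0 h1
  rw [log_div (by positivity) (by positivity), log_pow] at h2
  have h3 := le_log_factorial d
  have h4 : log δ = log d - log E := by
    rw [← log_div hd'.ne' hE'.ne', hδ]; congr 1; field_simp
  rw [h4, ← mul_assoc, ← hδ]
  linarith

open Real in
theorem neg_two_mul_le_log_one_sub {x : ℝ} (hx : 0 ≤ x) (hx1 : x ≤ 1 / 2) :
    -(2 * x) ≤ log (1 - x) := by
  have h := one_sub_inv_le_log_of_pos (x := 1 - x) (by linarith)
  have h1 : (1 - x)⁻¹ ≤ 1 + 2 * x := by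
    rw [inv_le_iff_one_le_mul₀ (by linarith)]
    nlinarith
  linarith

open Real in
-- The letter `o` takes at least half of the positions. Its factorial is removed by `c! * c ^ (N -
-- c) ≤ N!` instead of Stirling, and `log (1 - σ) ≥ -2σ` costs the term `2 σ ^ 2`, which is of
-- second order for rare letters.
theorem le_log_multinomial {Y : Type} [Fintype Y] [DecidableEq Y] (c : Y → ℕ) (o : Y) (φ : Y → ℝ)
    {N : ℕ} (hN : ∑ y, c y = N) (hN0 : 0 < N) (hc : ∀ y ≠ o, (c y : ℝ) = N * φ y)
    (hσ : ∑ y ∈ Finset.univ.erase o, φ y ≤ 1 / 2) :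
    N * (∑ y ∈ Finset.univ.erase o, φ y * (1 - log (φ y))
        - 2 * (∑ y ∈ Finset.univ.erase o, φ y) ^ 2) - Fintype.card Y * (log N + 1)
      ≤ log (Nat.multinomial Finset.univ c) := by
  have hN' : (0 : ℝ) < N := by exact_mod_cast hN0
  set σ := ∑ y ∈ Finset.univ.erase o, φ y with hσ_def
  have hφ : ∀ y ≠ o, 0 ≤ φ y := by
    intro y hy
    have : (0 : ℝ) ≤ N * φ y := by rw [← hc y hy]; positivity
    exact nonneg_of_mul_nonneg_right this hN'
  have hσ0 : 0 ≤ σ := Finset.sum_nonneg fun y hy => hφ y (Finset.ne_of_mem_erase hy)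
  have hsum : (c o : ℝ) + ∑ y ∈ Finset.univ.erase o, (c y : ℝ) = N := by
    rw [Finset.add_sum_erase _ (fun y => (c y : ℝ)) (Finset.mem_univ o)]
    exact_mod_cast hN
  have hsumφ : ∑ y ∈ Finset.univ.erase o, (c y : ℝ) = N * σ := by
    rw [hσ_def, Finset.mul_sum]
    exact Finset.sum_congr rfl fun y hy => hc y (Finset.ne_of_mem_erase hy)
  have hco : (c o : ℝ) = N * (1 - σ) := by linarith
  have hco0 : (0 : ℝ) < c o := by rw [hco]; apply mul_pos hN'; linarith
  have hle : c o ≤ N := by rw [← hN]; exact Finset.single_le_sum (by simp) (Finset.mem_univ o)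
  have hmul : (∏ y, ((c y).factorial : ℝ)) * Nat.multinomial Finset.univ c = N.factorial := by
    have := Nat.multinomial_spec Finset.univ c
    rw [hN] at this
    exact_mod_cast this
  have hpow : ((c o).factorial : ℝ) * (c o : ℝ) ^ (N - c o) ≤ N.factorial := by
    exact_mod_cast Nat.factorial_mul_pow_sub_le_factorial hle
  have h1 := log_le_log (by positivity) hpow
  have hmpos : (0 : ℝ) < Nat.multinomial Finset.univ c := by
    exact_mod_cast Nat.multinomial_pos _ _
  have h2 := congrArg log hmul
  rw [log_mul (by positivity) (by positivity), log_prod (fun y _ => by positivity),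
    ← Finset.add_sum_erase _ _ (Finset.mem_univ o)] at h2
  rw [log_mul (by positivity) (by positivity), log_pow, Nat.cast_sub hle] at h1
  have h3 : ∑ y ∈ Finset.univ.erase o, log (c y).factorial
      ≤ ∑ y ∈ Finset.univ.erase o, ((c y * log (c y) - c y) + (log N + 1)) := by
    refine Finset.sum_le_sum fun y _ => ?_
    have h4 := log_factorial_le (c y)
    have h5 : log (c y) ≤ log N := log_natCast_le
      (by rw [← hN]; exact Finset.single_le_sum (by simp) (Finset.mem_univ y))
    linarith
  rw [Finset.sum_add_distrib, Finset.sum_const, nsmul_eq_mul] at h3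
  have h6 : ((Finset.univ.erase o).card : ℝ) * (log N + 1) ≤ Fintype.card Y * (log N + 1) := by
    have : 0 ≤ log (N : ℝ) := log_natCast_nonneg N
    refine mul_le_mul_of_nonneg_right ?_ (by linarith)
    exact_mod_cast Finset.card_le_univ _
  have h7 : ∑ y ∈ Finset.univ.erase o, ((c y : ℝ) * log (c y) - c y)
      = N * σ * log N - N * ∑ y ∈ Finset.univ.erase o, φ y * (1 - log (φ y)) := by
    rw [← hsumφ, Finset.sum_mul, Finset.mul_sum, ← Finset.sum_sub_distrib]
    refine Finset.sum_congr rfl fun y hy => ?_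
    have hy' := Finset.ne_of_mem_erase hy
    rw [hc y hy']
    -- Letters of frequency zero are allowed, with `log 0 = 0`: local words outside the minimal
    -- pairs get frequency zero later.
    rcases (hφ y hy').eq_or_lt with h0 | h0
    · simp [← h0]
    · rw [log_mul hN'.ne' h0.ne']; ring
  have h8 : log (c o) = log N + log (1 - σ) := by
    rw [hco, log_mul hN'.ne' (by linarith)]
  have h9 : ((N : ℝ) - c o) * log (c o) ≥ N * σ * log N - 2 * N * σ ^ 2 := by
    have h10 := neg_two_mul_le_log_one_sub hσ0 hσ
    have h11 : (N : ℝ) - c o = N * σ := by rw [hco]; ring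
    have h12 := mul_le_mul_of_nonneg_left h10 (mul_nonneg hN'.le hσ0)
    rw [h8, h11]
    nlinarith
  nlinarith

/-! ### Realizable lengths and concatenation of configurations -/

theorem pos_of_two_le_minDist {s : ℕ} {C : Submodule (ZMod 2) (Fin s → ZMod 2)}
    (h : 2 ≤ minDist C) : 0 < s := by
  obtain ⟨c, -, hc, -⟩ := Nat.sInf_mem (Nat.nonempty_of_pos_sInf (lt_of_lt_of_le two_pos h))
  rcases Nat.eq_zero_or_pos s with rfl | hs
  · exact absurd (Subsingleton.elim c 0) hc
  · exact hs

theorem CheckType.len_pos (c : CheckType) : 0 < c.len := pos_of_two_le_minDist c.two_le_minDist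

theorem VarType.len_pos (c : VarType) : 0 < c.len := pos_of_two_le_minDist c.two_le_minDist

theorem VarType.vecMul_eq_zero_iff (c : VarType) (x : Fin c.dim → ZMod 2) :
    Matrix.vecMul x c.gen = 0 ↔ x = 0 := by
  constructor
  · intro h
    exact c.enc_injective (by simpa using h)
  · rintro rfl
    simp

namespace Params

variable {nc nv : ℕ} (P : Params nc nv)

theorem nonempty_var (P : Params nc nv) : Nonempty (Fin nv) := by
  by_contra h
  rw [not_nonempty_iff] at h
  simpa using P.lam_sum

theorem nonempty_chk (P : Params nc nv) : Nonempty (Fin nc) := by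
  by_contra h
  rw [not_nonempty_iff] at h
  simpa using P.rho_sum

theorem intLam_pos : 0 < P.intLam := by
  have := P.nonempty_var
  refine Finset.sum_pos (fun t _ => div_pos (P.lam_pos t) ?_) Finset.univ_nonempty
  exact_mod_cast (P.var t).len_pos

theorem intLam_pos' : 0 < (P.intLam : ℝ) := by exact_mod_cast P.intLam_pos

variable {P} {n m : ℕ}

theorem Realizable.varCount_cast (h : P.Realizable n) (t : Fin nv) :
    (P.varCount n t : ℝ) = n / P.intLam * (P.lam t / (P.var t).len) := by
  have := h.2.1 t
  rw [mul_div_assoc] at this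
  exact_mod_cast congrArg (Rat.cast (K := ℝ)) this

theorem Realizable.chkCount_cast (h : P.Realizable n) (t : Fin nc) :
    (P.chkCount n t : ℝ) = n / P.intLam * (P.rho t / (P.chk t).len) := by
  have := h.2.2 t
  rw [mul_div_assoc] at this
  exact_mod_cast congrArg (Rat.cast (K := ℝ)) this

theorem Realizable.edgeCount_cast (h : P.Realizable n) :
    (P.edgeCount n : ℝ) = n / P.intLam := by
  unfold edgeCount
  push_cast
  have h1 : ∀ t, (P.chkCount n t : ℝ) * (P.chk t).len = n / P.intLam * (P.rho t : ℝ) := by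
    intro t
    have : ((P.chk t).len : ℝ) ≠ 0 := by exact_mod_cast (P.chk t).len_pos.ne'
    rw [h.chkCount_cast]
    field_simp
  have h2 : ∑ t, (P.rho t : ℝ) = 1 := by exact_mod_cast P.rho_sum
  simp_rw [h1]
  rw [← Finset.mul_sum, h2, mul_one]

theorem Realizable.card_varSocket (h : P.Realizable n) :
    Fintype.card (P.VarSocket n) = P.edgeCount n := by
  have h0 : Fintype.card (P.VarSocket n) = ∑ t, P.varCount n t * (P.var t).len := by
    simp [VarSocket]
  have h1 : ∀ t, (P.varCount n t : ℝ) * (P.var t).len = n / P.intLam * (P.lam t : ℝ) := by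
    intro t
    have : ((P.var t).len : ℝ) ≠ 0 := by exact_mod_cast (P.var t).len_pos.ne'
    rw [h.varCount_cast]
    field_simp
  have h2 : ∑ t, (P.lam t : ℝ) = 1 := by exact_mod_cast P.lam_sum
  have h3 : (Fintype.card (P.VarSocket n) : ℝ) = P.edgeCount n := by
    rw [h.edgeCount_cast, h0]
    push_cast
    simp_rw [h1]
    rw [← Finset.mul_sum, h2, mul_one]
  exact_mod_cast h3

/-- At realizable lengths the floor in the node number is exact, so it commutes with addition. -/
theorem Realizable.varCount_add (hn : P.Realizable n) (hm : P.Realizable m) :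
    P.varCount (n + m) = P.varCount n + P.varCount m := by
  funext t
  have h : ((n + m : ℕ) / P.intLam) * P.lam t / (P.var t).len
      = ((P.varCount n t + P.varCount m t : ℕ) : ℚ) := by
    push_cast
    rw [hn.2.1, hm.2.1]
    ring
  rw [varCount, h, Nat.floor_natCast]
  rfl

theorem Realizable.chkCount_add (hn : P.Realizable n) (hm : P.Realizable m) :
    P.chkCount (n + m) = P.chkCount n + P.chkCount m := by
  funext t
  have h : ((n + m : ℕ) / P.intLam) * P.rho t / (P.chk t).len
      = ((P.chkCount n t + P.chkCount m t : ℕ) : ℚ) := by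
    push_cast
    rw [hn.2.2, hm.2.2]
    ring
  rw [chkCount, h, Nat.floor_natCast]
  rfl

theorem Realizable.add (hn : P.Realizable n) (hm : P.Realizable m) : P.Realizable (n + m) := by
  refine ⟨Nat.add_pos_left hn.1 m, fun t => ?_, fun t => ?_⟩
  · rw [hn.varCount_add hm]
    simp only [Pi.add_apply]
    push_cast
    rw [hn.2.1, hm.2.1]
    ring
  · rw [hn.chkCount_add hm]
    simp only [Pi.add_apply]
    push_cast
    rw [hn.2.2, hm.2.2]
    ring

theorem Realizable.mul_add (hn : P.Realizable n) (hm : P.Realizable m) (k : ℕ) :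
    P.Realizable (k * n + m) ∧ P.varCount (k * n + m) = k • P.varCount n + P.varCount m ∧
      P.chkCount (k * n + m) = k • P.chkCount n + P.chkCount m := by
  induction k with
  | zero => simpa using hm
  | succ k ih =>
    obtain ⟨h1, h2, h3⟩ := ih
    have h4 : (k + 1) * n + m = n + (k * n + m) := by ring
    rw [h4]
    refine ⟨hn.add h1, ?_, ?_⟩
    · rw [hn.varCount_add h1, h2, succ_nsmul']; abel
    · rw [hn.chkCount_add h1, h3, succ_nsmul']; abel

theorem Realizable.expCodewords_eq (h : P.Realizable n) (w : ℕ) :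
    P.expCodewords n w = ∑ d ∈ Finset.range (P.edgeCount n + 1), P.expTerm n w d :=
  P.expCodewords_eq_sum n w (by rw [h.card_varSocket, card_chkSocket])

variable (P) in
theorem expTerm_nonneg (n w d : ℕ) : 0 ≤ P.expTerm n w d := by
  unfold expTerm
  positivity

theorem Realizable.expTerm_le (h : P.Realizable n) (w : ℕ) {d : ℕ} (hd : d ≤ P.edgeCount n) :
    P.expTerm n w d ≤ P.expCodewords n w := by
  rw [h.expCodewords_eq]
  exact Finset.single_le_sum (fun d _ => P.expTerm_nonneg n w d)
    (Finset.mem_range.2 (Nat.lt_succ_of_le hd))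

theorem expTerm_pos_iff {w d : ℕ} : 0 < P.expTerm n w d ↔
    0 < configCount P.varWeight (P.varCount n) (w, d) ∧
    0 < configCount P.chkWeight (P.chkCount n) d ∧ d ≤ P.edgeCount n := by
  unfold expTerm
  constructor
  · intro h
    refine ⟨?_, ?_, ?_⟩ <;> by_contra h0
    · rw [Nat.eq_zero_of_not_pos h0] at h; simp at h
    · rw [Nat.eq_zero_of_not_pos h0] at h; simp at h
    · rw [Nat.choose_eq_zero_of_lt (not_le.1 h0)] at h; simp at h
  · rintro ⟨h1, h2, h3⟩
    have := Nat.choose_pos h3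
    positivity

theorem floor_eq_of_cast_eq {α : ℝ} {w : ℕ} (hw : (w : ℝ) = α * n) : ⌊α * n⌋₊ = w := by
  rw [← hw, Nat.floor_natCast]

theorem admissible_of_expTerm_pos {α : ℝ} (h : P.Realizable n) {w d : ℕ} (hw : (w : ℝ) = α * n)
    (hd : 0 < P.expTerm n w d) : P.Admissible α n := by
  refine ⟨h, ⟨w, hw⟩, ?_⟩
  rw [floor_eq_of_cast_eq hw]
  exact hd.trans_le (h.expTerm_le w (expTerm_pos_iff.1 hd).2.2)

/-- The largest summand loses at most the factor `E + 1`. -/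
theorem Admissible.exists_expTerm {α : ℝ} (h : P.Admissible α n) :
    ∃ w d : ℕ, (w : ℝ) = α * n ∧ 0 < P.expTerm n w d ∧
      P.expCodewords n w ≤ (P.edgeCount n + 1) * P.expTerm n w d := by
  obtain ⟨hr, ⟨w, hw⟩, hpos⟩ := h
  rw [floor_eq_of_cast_eq hw] at hpos
  obtain ⟨d, hd, hmax⟩ := Finset.exists_max_image (Finset.range (P.edgeCount n + 1))
    (fun d => P.expTerm n w d) ⟨0, by simp⟩
  have hle : P.expCodewords n w ≤ (P.edgeCount n + 1) * P.expTerm n w d := by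
    rw [hr.expCodewords_eq]
    have := Finset.sum_le_card_nsmul _ _ _ hmax
    rw [Finset.card_range, nsmul_eq_mul] at this
    exact_mod_cast this
  refine ⟨w, d, hw, ?_, hle⟩
  exact pos_of_mul_pos_right (hpos.trans_le hle) (by positivity)

/-- The exponential growth rate guaranteed by the summand `expTerm n w d`. -/
def termRate (P : Params nc nv) (n w d : ℕ) : ℝ :=
  (Real.log (P.expTerm n w d) - 2 * Real.log (P.edgeCount n) - 2) / n

open Real in
/-- Supermultiplicativity: concatenating `k` copies of a configuration for `n` variable nodes with
one for `s` variable nodes. -/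
theorem le_log_expCodewords_mul_add {s w w' d d' : ℕ} (hn : P.Realizable n) (hs : P.Realizable s)
    (hd0 : 0 < d) (hdE : d < P.edgeCount n) (ht : 0 < P.expTerm n w d)
    (ht' : 0 < P.expTerm s w' d') (k : ℕ) :
    k * (log (P.expTerm n w d) - 2 * log (P.edgeCount n) - 2) +
        P.edgeCount s * (log (d / P.edgeCount n) + log (1 - d / P.edgeCount n))
      ≤ log (P.expCodewords (k * n + s) (k * w + w')) := by
  obtain ⟨hr, hv, hc⟩ := hn.mul_add hs k
  obtain ⟨hv1, hc1, -⟩ := expTerm_pos_iff.1 ht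
  obtain ⟨hv2, hc2, hd'⟩ := expTerm_pos_iff.1 ht'
  have hEk : P.edgeCount (k * n + s) = k * P.edgeCount n + P.edgeCount s := by
    simp only [edgeCount, hc, Finset.mul_sum, ← Finset.sum_add_distrib]
    refine Finset.sum_congr rfl fun t _ => ?_
    simp only [Pi.add_apply, Pi.smul_apply, smul_eq_mul]
    ring
  have hle : k * d + d' ≤ P.edgeCount (k * n + s) := by
    rw [hEk]
    exact Nat.add_le_add (Nat.mul_le_mul_left _ hdE.le) hd'
  set E := P.edgeCount n
  set E' := P.edgeCount s
  have hVle : configCount P.varWeight (P.varCount n) (w, d) ^ k ≤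
      configCount P.varWeight (P.varCount (k * n + s)) (k * w + w', k * d + d') := by
    have h1 := configCount_mul_le P.varWeight (k • P.varCount n) (P.varCount s) (k • (w, d))
      (w', d')
    rw [hv]
    calc _ ≤ configCount P.varWeight (k • P.varCount n) (k • (w, d)) := pow_configCount_le _ _ _ _
      _ ≤ _ := Nat.le_mul_of_pos_right _ hv2
      _ ≤ _ := by simpa using h1
  have hCle : configCount P.chkWeight (P.chkCount n) d ^ k ≤
      configCount P.chkWeight (P.chkCount (k * n + s)) (k * d + d') := by
    have h1 := configCount_mul_le P.chkWeight (k • P.chkCount n) (P.chkCount s) (k • d) d'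
    rw [hc]
    calc _ ≤ configCount P.chkWeight (k • P.chkCount n) (k • d) := pow_configCount_le _ _ _ _
      _ ≤ _ := Nat.le_mul_of_pos_right _ hc2
      _ ≤ _ := by simpa using h1
  set a := configCount P.varWeight (P.varCount n) (w, d)
  set b := configCount P.chkWeight (P.chkCount n) d
  have hbin : (0 : ℝ) < (P.edgeCount (k * n + s)).choose (k * d + d') := by
    exact_mod_cast Nat.choose_pos hle
  have hbin1 : (0 : ℝ) < E.choose d := by exact_mod_cast Nat.choose_pos hdE.le
  have ha : (0 : ℝ) < a := by exact_mod_cast hv1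
  have hb : (0 : ℝ) < b := by exact_mod_cast hc1
  have h1 : (a : ℝ) ^ k * (b : ℝ) ^ k / (P.edgeCount (k * n + s)).choose (k * d + d')
      ≤ P.expCodewords (k * n + s) (k * w + w') := by
    refine le_trans ?_ (hr.expTerm_le _ hle)
    unfold expTerm
    gcongr
    · exact_mod_cast hVle
    · exact_mod_cast hCle
  have h2 := log_le_log (by positivity) h1
  rw [log_div (by positivity) hbin.ne', log_mul (by positivity) (by positivity), log_pow,
    log_pow] at h2
  have hE0 : (0 : ℝ) < E := by exact_mod_cast hd0.trans hdE
  have hd0' : (0 : ℝ) < d := by exact_mod_cast hd0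
  have hx0 : (0 : ℝ) < d / E := by positivity
  have hx1 : (d : ℝ) / E < 1 := by rw [div_lt_one hE0]; exact_mod_cast hdE
  -- The long binomial coefficient is bounded at the point `d / E` of one copy. Then `k` copies cost
  -- `k` times the entropy of one copy, and the remainder at most its edge number times two
  -- nonpositive logarithms.
  have h3 := log_choose_le hle hx0 hx1
  have h4 := le_log_choose_of_lt hdE hd0
  have h5 : log (P.expTerm n w d) = log a + log b - log (E.choose d) := by
    unfold expTerm
    rw [log_div (by positivity) hbin1.ne', log_mul ha.ne' hb.ne']
  rw [h5]
  rw [hEk] at h2 h3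
  push_cast at h2 h3
  have hl0 : log ((d : ℝ) / E) ≤ 0 := log_nonpos hx0.le hx1.le
  have hl1 : log (1 - (d : ℝ) / E) ≤ 0 := log_nonpos (by linarith) (by linarith)
  have hd'' : (d' : ℝ) ≤ E' := by exact_mod_cast hd'
  have h6 := mul_le_mul_of_nonpos_right hd'' hl0
  have h7 := mul_le_mul_of_nonpos_right (sub_le_self (E' : ℝ) (by positivity : (0 : ℝ) ≤ d')) hl1
  have h8 := mul_le_mul_of_nonneg_left h4 (by positivity : (0 : ℝ) ≤ k)
  nlinarith

open Real in
-- Every admissible `m` equals `k * n + s`, where `s` is the least admissible length in its residue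
-- class mod `n`. There are finitely many classes, so the cost of the remainders is bounded.
theorem exists_le_log_expCodewords {α : ℝ} {w d : ℕ} (hn : P.Realizable n) (hw : (w : ℝ) = α * n)
    (hd0 : 0 < d) (hdE : d < P.edgeCount n) (ht : 0 < P.expTerm n w d) :
    ∃ B, ∀ m, P.Admissible α m →
      m * P.termRate n w d - B ≤ log (P.expCodewords m ⌊α * m⌋₊) := by
  classical
  have hn0 : 0 < n := hn.1
  have hn0' : (0 : ℝ) < n := by exact_mod_cast hn0
  -- A class without admissible lengths gets the value `sInf ∅ = 0`, which adds nothing to `B₀`;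
  -- only the class of `m` is evaluated, and it contains `m`.
  let g : ℕ → ℕ := fun i => sInf {s | P.Admissible α s ∧ s % n = i}
  let B₀ : ℕ := ∑ i ∈ Finset.range n, g i
  set v := P.termRate n w d with hv
  set K := -(log ((d : ℝ) / P.edgeCount n) + log (1 - d / P.edgeCount n)) with hK
  have hE0 : (0 : ℝ) < P.edgeCount n := by exact_mod_cast hd0.trans hdE
  have hK0 : 0 ≤ K := by
    have hd0' : (0 : ℝ) < d := by exact_mod_cast hd0
    have hx0 : (0 : ℝ) < d / P.edgeCount n := by positivity
    have hx1 : (d : ℝ) / P.edgeCount n < 1 := by rw [div_lt_one hE0]; exact_mod_cast hdE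
    have hl0 : log ((d : ℝ) / P.edgeCount n) ≤ 0 := log_nonpos hx0.le hx1.le
    have hl1 : log (1 - (d : ℝ) / P.edgeCount n) ≤ 0 := log_nonpos (by linarith) (by linarith)
    linarith
  refine ⟨B₀ * |v| + B₀ / P.intLam * K, fun m hm => ?_⟩
  have hmem : g (m % n) ∈ {s | P.Admissible α s ∧ s % n = m % n} := Nat.sInf_mem ⟨m, hm, rfl⟩
  have hgm : g (m % n) ≤ m := Nat.sInf_le ⟨hm, rfl⟩
  have hgB : g (m % n) ≤ B₀ :=
    Finset.single_le_sum (f := g) (by simp) (Finset.mem_range.2 (Nat.mod_lt _ hn0))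
  generalize g (m % n) = s at hmem hgm hgB
  obtain ⟨hs, hmod⟩ := hmem
  obtain ⟨k, hk⟩ : ∃ k, m = k * n + s := by
    obtain ⟨k, hk⟩ := (Nat.modEq_iff_dvd' hgm).1 hmod
    exact ⟨k, by rw [mul_comm, ← hk]; omega⟩
  obtain ⟨w', d', hw', ht', -⟩ := hs.exists_expTerm
  have h1 := le_log_expCodewords_mul_add hn hs.1 hd0 hdE ht ht' k
  have hfl : ⌊α * m⌋₊ = k * w + w' := by
    apply floor_eq_of_cast_eq
    rw [hk]
    push_cast
    rw [hw, hw']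
    ring
  rw [hfl]
  rw [← hk, hs.1.edgeCount_cast] at h1
  have h2 : log (P.expTerm n w d) - 2 * log (P.edgeCount n) - 2 = n * v := by
    rw [hv, termRate]; field_simp
  rw [h2, ← neg_neg (log ((d : ℝ) / P.edgeCount n) + log (1 - d / P.edgeCount n)), ← hK] at h1
  have hgB' : (s : ℝ) ≤ B₀ := by exact_mod_cast hgB
  have h3 : (s : ℝ) / P.intLam * K ≤ B₀ / P.intLam * K := by
    have := P.intLam_pos'
    gcongr
  have h4 : (s : ℝ) * v ≤ B₀ * |v| :=
    (mul_le_mul_of_nonneg_left (le_abs_self v) (by positivity)).trans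
      (mul_le_mul_of_nonneg_right hgB' (abs_nonneg v))
  have h5 : (m : ℝ) = k * n + s := by exact_mod_cast hk
  rw [h5]
  nlinarith

open Real in
-- There are no more codewords than words, and the number of information bits is linear in `n`. This
-- makes the supremum of the rates finite.
theorem exists_log_expCodewords_le (P : Params nc nv) :
    ∃ K : ℝ, ∀ n w, P.Realizable n → log (P.expCodewords n w) ≤ K * n := by
  refine ⟨∑ t, (P.lam t / (P.var t).len / P.intLam : ℝ) * ((P.var t).dim * log 2), ?_⟩
  intro n w h
  have hW : Nonempty (P.Wiring n) :=
    ⟨Fintype.equivOfCardEq (by rw [h.card_varSocket, card_chkSocket])⟩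
  have hcard : (0 : ℝ) < Fintype.card (P.Wiring n) := by exact_mod_cast Fintype.card_pos
  have hle : P.expCodewords n w ≤ Fintype.card (P.Word n) := by
    unfold expCodewords
    rw [div_le_iff₀ hcard]
    have : ∀ σ ∈ (Finset.univ : Finset (P.Wiring n)),
        (numCodewords σ w : ℝ) ≤ Fintype.card (P.Word n) := by
      intro σ _
      classical
      unfold numCodewords
      rw [Nat.card_eq_fintype_card]
      exact_mod_cast Fintype.card_subtype_le _
    have := Finset.sum_le_card_nsmul _ _ _ this
    rwa [Finset.card_univ, nsmul_eq_mul, mul_comm] at this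
  have h0 : 0 ≤ P.expCodewords n w := by unfold expCodewords; positivity
  have h1 : log (Fintype.card (P.Word n)) =
      (∑ t, (P.lam t / (P.var t).len / P.intLam : ℝ) * ((P.var t).dim * log 2)) * n := by
    have : Fintype.card (P.Word n) = ∏ t, 2 ^ ((P.var t).dim * P.varCount n t) := by
      simp [Word, pow_mul]
    rw [this]
    push_cast
    rw [log_prod (fun t _ => by positivity), Finset.sum_mul]
    refine Finset.sum_congr rfl fun t _ => ?_
    rw [log_pow]
    push_cast
    rw [h.varCount_cast]
    ring
  rw [← h1]
  rcases h0.eq_or_lt with h2 | h2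
  · rw [← h2, log_zero]
    exact log_natCast_nonneg _
  · exact log_le_log h2 hle

end Params

namespace Params

variable {nc nv : ℕ} {P : Params nc nv} {n : ℕ}

/-! ### Existence of the limit -/

/-- A bound for the ratio of the input and output weights of the variable nodes. -/
def weightRatio (P : Params nc nv) : ℕ := ∑ t, ((P.var t).dim + (P.var t).len)

theorem weightRatio_pos (P : Params nc nv) : 0 < P.weightRatio := by
  have := P.nonempty_var
  exact Finset.sum_pos (fun t _ => Nat.add_pos_right _ (P.var t).len_pos) Finset.univ_nonempty

/-- The encoder is injective, so input and output weights vanish together; otherwise both lie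
between one and `weightRatio`. -/
theorem varWeight_le (t : Fin nv) (x : Fin (P.var t).dim → ZMod 2) :
    (P.varWeight t x).2 ≤ P.weightRatio * (P.varWeight t x).1 ∧
      (P.varWeight t x).1 ≤ P.weightRatio * (P.varWeight t x).2 := by
  have hle : (P.var t).dim + (P.var t).len ≤ P.weightRatio :=
    Finset.single_le_sum (f := fun t => (P.var t).dim + (P.var t).len) (by simp)
      (Finset.mem_univ t)
  have h1 : (P.varWeight t x).1 ≤ (P.var t).dim := by
    simpa [varWeight] using hammingNorm_le_card_fintype (x := x)
  have h2 : (P.varWeight t x).2 ≤ (P.var t).len := by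
    simpa [varWeight] using hammingNorm_le_card_fintype (x := Matrix.vecMul x (P.var t).gen)
  by_cases hx : x = 0
  · simp [varWeight, hx]
  · have h3 : 0 < (P.varWeight t x).1 := hammingNorm_pos_iff.2 hx
    have h4 : 0 < (P.varWeight t x).2 :=
      hammingNorm_pos_iff.2 fun h => hx (((P.var t).vecMul_eq_zero_iff x).1 h)
    constructor <;> nlinarith

theorem weight_le_of_configCount_pos {m : Fin nv → ℕ} {w d : ℕ}
    (h : 0 < configCount P.varWeight m (w, d)) :
    d ≤ P.weightRatio * w ∧ w ≤ P.weightRatio * d := by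
  obtain ⟨⟨ω, hω⟩⟩ := (Nat.card_pos_iff.1 h).1
  rw [Prod.ext_iff] at hω
  simp only [Prod.fst_sum, Prod.snd_sum] at hω
  rw [← hω.1, ← hω.2]
  simp only [Finset.mul_sum]
  exact ⟨Finset.sum_le_sum fun t _ => Finset.sum_le_sum fun a _ => (varWeight_le t _).1,
    Finset.sum_le_sum fun t _ => Finset.sum_le_sum fun a _ => (varWeight_le t _).2⟩

/-- For small `α` the fraction `d / E` stays strictly inside the unit interval, as the entropy
estimate of the concatenation argument needs. -/
theorem edgeWeight_mem_Ioo {α : ℝ} (hα : 0 < α) (hα' : P.weightRatio * α * P.intLam < 1) {w d : ℕ}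
    (hn : P.Realizable n) (hw : (w : ℝ) = α * n) (ht : 0 < P.expTerm n w d) :
    0 < d ∧ d < P.edgeCount n := by
  have hn0 : (0 : ℝ) < n := by exact_mod_cast hn.1
  have hL := P.intLam_pos'
  obtain ⟨h1, h2⟩ := weight_le_of_configCount_pos (expTerm_pos_iff.1 ht).1
  constructor
  · rcases Nat.eq_zero_or_pos d with rfl | hd
    · have : w = 0 := by simpa using h2
      rw [this, Nat.cast_zero] at hw
      exact absurd hw (mul_pos hα hn0).ne
    · exact hd
  · have h3 : (d : ℝ) < P.edgeCount n := by
      rw [hn.edgeCount_cast, lt_div_iff₀ hL]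
      have h4 : (d : ℝ) ≤ P.weightRatio * w := by exact_mod_cast h1
      rw [hw] at h4
      nlinarith [mul_le_mul_of_nonneg_right h4 hL.le, mul_lt_mul_of_pos_right hα' hn0]
    exact_mod_cast h3

open Real in
theorem tendsto_log_add_div (a b : ℝ) :
    Tendsto (fun n : ℕ => (a * log n + b) / n) atTop (𝓝 0) := by
  have h1 : Tendsto (fun x : ℝ => (a * log x + b) / x) atTop (𝓝 0) := by
    refine IsLittleO.tendsto_div_nhds_zero ?_
    exact (isLittleO_log_id_atTop.const_mul_left a).add
      (isLittleO_const_left.2 (Or.inr tendsto_norm_atTop_atTop))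
  exact h1.comp tendsto_natCast_atTop_atTop

open Real in
theorem exists_log_edgeCount_le (P : Params nc nv) :
    ∃ B : ℝ, 0 ≤ B ∧ ∀ n, P.Realizable n →
      log (P.edgeCount n) ≤ log n + B ∧ log (P.edgeCount n + 1) ≤ log n + B := by
  have hL := P.intLam_pos'
  refine ⟨log (1 / P.intLam + 1), log_nonneg (by simp [hL.le]), fun n hn => ?_⟩
  have hn1 : (1 : ℝ) ≤ n := by exact_mod_cast hn.1
  rw [hn.edgeCount_cast, ← log_mul (by positivity) (by positivity)]
  constructor
  · refine log_le_log (by positivity) ?_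
    rw [mul_add, mul_one_div]
    linarith
  · refine log_le_log (by positivity) ?_
    rw [mul_add, mul_one_div]
    linarith

open Real in
-- A Fekete argument: the limit is the supremum of `termRate` over all summands of relative weight
-- `α`. Concatenation gives the lower estimate; the largest summand gives the upper one, up to
-- `O(log n / n)`.
theorem spectralShape_spec {α : ℝ} (hα : 0 < α) (hα' : P.weightRatio * α * P.intLam < 1)
    (hfreq : ∃ᶠ n in atTop, P.Admissible α n) :
    Tendsto (P.normLogExp α) (P.admissibleFilter α) (𝓝 (P.spectralShape α)) ∧
      ∀ n w d : ℕ, P.Realizable n → (w : ℝ) = α * n → 0 < P.expTerm n w d →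
        P.termRate n w d ≤ P.spectralShape α := by
  have hne : (P.admissibleFilter α).NeBot := by
    rw [admissibleFilter, ← frequently_mem_iff_neBot]
    exact hfreq
  let V : Set ℝ := {v | ∃ n w d : ℕ, P.Realizable n ∧ (w : ℝ) = α * n ∧ 0 < P.expTerm n w d ∧
    v = P.termRate n w d}
  obtain ⟨K, hK⟩ := P.exists_log_expCodewords_le
  have hbdd : BddAbove V := by
    refine ⟨K, ?_⟩
    rintro _ ⟨n, w, d, hn, hw, ht, rfl⟩
    have hn0 : (0 : ℝ) < n := by exact_mod_cast hn.1
    rw [termRate, div_le_iff₀ hn0]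
    have h1 := log_le_log ht (hn.expTerm_le w (expTerm_pos_iff.1 ht).2.2)
    have h2 := log_natCast_nonneg (P.edgeCount n)
    linarith [hK n w hn]
  have hVne : V.Nonempty := by
    obtain ⟨n, hn⟩ := hfreq.exists
    obtain ⟨w, d, hw, ht, -⟩ := hn.exists_expTerm
    exact ⟨_, n, w, d, hn.1, hw, ht, rfl⟩
  have hlower : ∀ v ∈ V, ∀ ε > 0, ∀ᶠ n in P.admissibleFilter α, v - ε ≤ P.normLogExp α n := by
    rintro _ ⟨n, w, d, hn, hw, ht, rfl⟩ ε hε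
    obtain ⟨hd0, hdE⟩ := edgeWeight_mem_Ioo hα hα' hn hw ht
    obtain ⟨B, hB⟩ := exists_le_log_expCodewords hn hw hd0 hdE ht
    rw [admissibleFilter, eventually_inf_principal]
    have h1 := (tendsto_log_add_div 0 B).eventually_lt_const hε
    filter_upwards [h1] with m hm hadm
    have hm0 : (0 : ℝ) < m := by exact_mod_cast hadm.1.1
    have h2 := hB m hadm
    rw [normLogExp, one_div, inv_mul_eq_div, le_div_iff₀ hm0]
    rw [div_lt_iff₀ hm0] at hm
    linarith
  have hupper : ∀ ε > 0, ∀ᶠ n in P.admissibleFilter α, P.normLogExp α n ≤ sSup V + ε := by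
    intro ε hε
    obtain ⟨B, -, hB⟩ := P.exists_log_edgeCount_le
    rw [admissibleFilter, eventually_inf_principal]
    have h1 := (tendsto_log_add_div 3 (3 * B + 2)).eventually_lt_const hε
    filter_upwards [h1] with m hm hadm
    have hm0 : (0 : ℝ) < m := by exact_mod_cast hadm.1.1
    obtain ⟨w, d, hw, ht, hle⟩ := hadm.exists_expTerm
    have h2 : P.termRate m w d ≤ sSup V := le_csSup hbdd ⟨m, w, d, hadm.1, hw, ht, rfl⟩
    have h3 := hadm.2.2
    rw [floor_eq_of_cast_eq hw] at h3
    have h4 := log_le_log h3 hle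
    rw [log_mul (by positivity) ht.ne'] at h4
    obtain ⟨h5, h6⟩ := hB m hadm.1
    rw [normLogExp, floor_eq_of_cast_eq hw, one_div, inv_mul_eq_div, div_le_iff₀ hm0]
    rw [termRate, div_le_iff₀ hm0] at h2
    rw [div_lt_iff₀ hm0] at hm
    linarith
  have htend : Tendsto (P.normLogExp α) (P.admissibleFilter α) (𝓝 (sSup V)) := by
    rw [tendsto_order]
    constructor
    · intro a ha
      obtain ⟨v, hv, hav⟩ := exists_lt_of_lt_csSup hVne ha
      filter_upwards [hlower v hv ((v - a) / 2) (by linarith)] with n hn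
      linarith
    · intro a ha
      filter_upwards [hupper ((a - sSup V) / 2) (by linarith)] with n hn
      linarith
  have heq : P.spectralShape α = sSup V := htend.limUnder_eq
  rw [heq]
  exact ⟨htend, fun n w d hn hw ht => le_csSup hbdd ⟨n, w, d, hn, hw, ht, rfl⟩⟩

end Params

/-! ### The parameters of the expansion -/

theorem exists_hammingNorm_eq_minDist {s : ℕ} {C : Submodule (ZMod 2) (Fin s → ZMod 2)}
    (h : 2 ≤ minDist C) : ∃ c ∈ C, c ≠ 0 ∧ hammingNorm c = minDist C :=
  Nat.sInf_mem (Nat.nonempty_of_pos_sInf (lt_of_lt_of_le two_pos h))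

theorem minDist_le {s : ℕ} {C : Submodule (ZMod 2) (Fin s → ZMod 2)} {c : Fin s → ZMod 2}
    (hc : c ∈ C) (hc0 : c ≠ 0) : minDist C ≤ hammingNorm c :=
  Nat.sInf_le ⟨c, hc, hc0, rfl⟩

/-- Injectivity of the encoder excludes pairs with exactly one zero entry, so `monomials` misses
only the constant term. -/
theorem VarType.mem_monomials {c : VarType} {x : Fin c.dim → ZMod 2} (hx : x ≠ 0) :
    (hammingNorm x, hammingNorm (Matrix.vecMul x c.gen)) ∈ c.monomials := by
  simp only [VarType.monomials, Finset.mem_filter, Finset.mem_product, Finset.mem_Icc]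
  refine ⟨⟨⟨hammingNorm_pos_iff.2 hx, ?_⟩, hammingNorm_pos_iff.2 ?_, ?_⟩, ?_⟩
  · simpa using hammingNorm_le_card_fintype (x := x)
  · exact fun h => hx ((c.vecMul_eq_zero_iff x).1 h)
  · simpa using hammingNorm_le_card_fintype (x := Matrix.vecMul x c.gen)
  · exact Nat.card_pos_iff.2 ⟨⟨⟨x, rfl, rfl⟩⟩, inferInstance⟩

theorem VarType.of_mem_monomials {c : VarType} {p : ℕ × ℕ} (hp : p ∈ c.monomials) :
    1 ≤ p.1 ∧ 2 ≤ p.2 ∧ 0 < c.iowefCoeff p.1 p.2 := by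
  simp only [VarType.monomials, Finset.mem_filter, Finset.mem_product, Finset.mem_Icc] at hp
  refine ⟨hp.1.1.1, ?_, hp.2⟩
  obtain ⟨⟨x, hx1, hx2⟩⟩ := (Nat.card_pos_iff.1 hp.2).1
  rw [← hx2]
  refine c.two_le_minDist.trans (minDist_le ⟨x, rfl⟩ ?_)
  intro h
  replace h : Matrix.vecMul x c.gen = 0 := h
  rw [h, hammingNorm_zero] at hx2
  omega

/-- Sums over the nonzero input words, arranged by weight. -/
theorem VarType.sum_words (c : VarType) (g : ℕ × ℕ → ℝ) :
    ∑ x ∈ Finset.univ.erase (0 : Fin c.dim → ZMod 2),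
        g (hammingNorm x, hammingNorm (Matrix.vecMul x c.gen))
      = ∑ p ∈ c.monomials, c.iowefCoeff p.1 p.2 * g p := by
  rw [← Finset.sum_fiberwise_of_maps_to
    (g := fun x => (hammingNorm x, hammingNorm (Matrix.vecMul x c.gen))) (t := c.monomials)]
  · refine Finset.sum_congr rfl fun p hp => ?_
    have hp1 := (VarType.of_mem_monomials hp).1
    rw [Finset.sum_congr rfl (g := fun _ => g p)
      (fun x hx => by rw [(Finset.mem_filter.1 hx).2]), Finset.sum_const, nsmul_eq_mul,
      VarType.iowefCoeff, Nat.card_eq_fintype_card, Fintype.card_subtype]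
    congr 3
    ext x
    simp only [Finset.mem_filter, Finset.mem_erase, Finset.mem_univ, and_true, true_and,
      Prod.ext_iff, and_iff_right_iff_imp]
    rintro ⟨h, -⟩ rfl
    rw [hammingNorm_zero] at h
    omega
  · intro x hx
    exact VarType.mem_monomials (Finset.ne_of_mem_erase hx)

namespace Params

variable {nc nv : ℕ} (P : Params nc nv)

theorem exists_monomial : ∃ t, ∃ p, p ∈ (P.var t).monomials := by
  obtain ⟨t⟩ := P.nonempty_var
  obtain ⟨_, ⟨x, rfl⟩, hx, -⟩ := exists_hammingNorm_eq_minDist (P.var t).two_le_minDist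
  refine ⟨t, _, VarType.mem_monomials (x := x) ?_⟩
  rintro rfl
  simp at hx

theorem r_le (t : Fin nc) : P.r ≤ minDist (P.chk t).code := ciInf_le (OrderBot.bddBelow _) t

theorem exists_minDist_eq_r : ∃ t, minDist (P.chk t).code = P.r := by
  have := P.nonempty_chk
  exact ciInf_mem fun t => minDist (P.chk t).code

theorem two_le_r : 2 ≤ P.r := by
  obtain ⟨t, ht⟩ := P.exists_minDist_eq_r
  rw [← ht]
  exact (P.chk t).two_le_minDist

theorem two_le_r_cast : (2 : ℝ) ≤ P.r := by exact_mod_cast P.two_le_r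

theorem psi_pos : 0 < P.psi := by
  have := P.two_le_r_cast
  unfold psi
  apply div_pos <;> linarith

/-- The exponents `r` and `ψ` are conjugate; this makes the check and variable parameters multiply
to `δ` in the upper bound. -/
theorem inv_psi : 1 / P.psi = 1 - 1 / P.r := by
  have := P.two_le_r_cast
  unfold psi
  have : (P.r : ℝ) - 1 ≠ 0 := by linarith
  field_simp

theorem psi_le_two : P.psi ≤ 2 := by
  have := P.two_le_r_cast
  unfold psi
  rw [div_le_iff₀] <;> linarith

theorem T_set_finite :
    {x | ∃ t, ∃ p ∈ (P.var t).monomials, x = ((p.2 : ℝ) - P.psi) / (p.1 : ℝ)}.Finite := by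
  have : {x | ∃ t, ∃ p ∈ (P.var t).monomials, x = ((p.2 : ℝ) - P.psi) / (p.1 : ℝ)}
      = ⋃ t, (fun p : ℕ × ℕ => ((p.2 : ℝ) - P.psi) / (p.1 : ℝ)) '' (P.var t).monomials := by
    ext x
    simp [eq_comm]
  rw [this]
  exact Set.finite_iUnion fun t => (Finset.finite_toSet _).image _

theorem T_le {t : Fin nv} {p : ℕ × ℕ} (hp : p ∈ (P.var t).monomials) :
    P.T ≤ ((p.2 : ℝ) - P.psi) / p.1 :=
  csInf_le P.T_set_finite.bddBelow ⟨t, p, hp, rfl⟩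

theorem exists_mem_minPairs : ∃ t, ∃ p, p ∈ P.minPairs t := by
  have h : P.T ∈ {x | ∃ t, ∃ p ∈ (P.var t).monomials, x = ((p.2 : ℝ) - P.psi) / (p.1 : ℝ)} := by
    refine Set.Nonempty.csInf_mem ?_ P.T_set_finite
    obtain ⟨t, p, hp⟩ := P.exists_monomial
    exact ⟨_, t, p, hp, rfl⟩
  obtain ⟨t, p, hp, hT⟩ := h
  exact ⟨t, p, by classical exact Finset.mem_filter.2 ⟨hp, hT.symm⟩⟩

variable {P} in
theorem mem_minPairs {t : Fin nv} {p : ℕ × ℕ} :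
    p ∈ P.minPairs t ↔ p ∈ (P.var t).monomials ∧ (p.2 : ℝ) = P.psi + p.1 * P.T := by
  unfold minPairs
  rw [Finset.mem_filter, and_congr_right_iff]
  intro hp
  have h1 := (VarType.of_mem_monomials hp).1
  have : (p.1 : ℝ) ≠ 0 := by exact_mod_cast (by omega : p.1 ≠ 0)
  rw [div_eq_iff this]
  constructor <;> intro h <;> linarith

theorem psi_add_mul_T_le {t : Fin nv} {p : ℕ × ℕ} (hp : p ∈ (P.var t).monomials) :
    P.psi + p.1 * P.T ≤ p.2 := by
  have h1 : 0 < (p.1 : ℝ) := by exact_mod_cast (VarType.of_mem_monomials hp).1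
  have := P.T_le hp
  rw [le_div_iff₀ h1] at this
  linarith

/-- Output weights are at least `2`, while `ψ ≤ 2`. The sign is needed to multiply the estimate of
`δ` by `T / ψ`. -/
theorem T_nonneg : 0 ≤ P.T := by
  obtain ⟨t, p, hp⟩ := P.exists_mem_minPairs
  obtain ⟨hp, h⟩ := mem_minPairs.1 hp
  have h1 : 0 < (p.1 : ℝ) := by exact_mod_cast (VarType.of_mem_monomials hp).1
  have h2 : 2 ≤ (p.2 : ℝ) := by exact_mod_cast (VarType.of_mem_monomials hp).2.1
  have := P.psi_le_two
  by_contra h0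
  nlinarith

theorem C_pos : 0 < P.C := by
  have hr := P.two_le_r_cast
  unfold C
  refine mul_pos (by linarith) ?_
  obtain ⟨t, ht⟩ := P.exists_minDist_eq_r
  refine Finset.sum_pos (fun t ht => ?_) ⟨t, by simp [ht]⟩
  rw [Finset.mem_filter] at ht
  have h1 : (0 : ℝ) < P.rho t := by exact_mod_cast P.rho_pos t
  have h2 : (0 : ℝ) < (P.chk t).len := by exact_mod_cast (P.chk t).len_pos
  have h3 : 0 < (P.chk t).wefCoeff P.r := by
    obtain ⟨c, hc, -, hcr⟩ := exists_hammingNorm_eq_minDist (P.chk t).two_le_minDist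
    exact Nat.card_pos_iff.2 ⟨⟨⟨c, hc, hcr.trans ht.2⟩⟩, inferInstance⟩
  positivity

/-! ### The polynomials `Q1` and `Q2` as sums over minimal pairs -/

/-- Sums over the pairs that achieve the minimum `T`, weighted with the fractions `λ_t / q_t` and
the coefficients of the input-output weight enumerating functions. -/
def minSum (g : ℕ × ℕ → ℝ) : ℝ :=
  ∑ t, (P.lam t : ℝ) / (P.var t).len * ∑ p ∈ P.minPairs t, (P.var t).iowefCoeff p.1 p.2 * g p

/-- The summands of `Q₁` and `Q₂`, without coefficients. -/
def minTerm (x : ℝ) (p : ℕ × ℕ) : ℝ :=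
  P.C ^ ((p.2 : ℝ) / P.r) * ((P.intLam : ℝ) / Real.exp 1) ^ ((p.1 : ℝ) * P.T / P.psi) * x ^ p.1

theorem sum_minTypes (f : Fin nv → ℝ) (hf : ∀ t, P.minPairs t = ∅ → f t = 0) :
    ∑ t ∈ P.minTypes, f t = ∑ t, f t := by
  refine Finset.sum_subset (Finset.subset_univ _) fun t _ ht => hf t ?_
  simpa [minTypes] using ht

theorem Q1_eq (x : ℝ) : P.Q1 x = P.minSum fun p => p.2 * P.minTerm x p := by
  unfold Q1 minSum minTerm
  rw [sum_minTypes _ _ fun t ht => by simp [ht]]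
  refine Finset.sum_congr rfl fun t _ => ?_
  congr 1
  refine Finset.sum_congr rfl fun p _ => ?_
  ring

theorem Q2_eq (x : ℝ) : P.Q2 x = P.minSum fun p => p.1 * P.minTerm x p := by
  unfold Q2 minSum minTerm
  rw [sum_minTypes _ _ fun t ht => by simp [ht]]
  refine Finset.sum_congr rfl fun t _ => ?_
  congr 1
  refine Finset.sum_congr rfl fun p _ => ?_
  ring

variable {P}

theorem minSum_congr {g h : ℕ × ℕ → ℝ} (H : ∀ t, ∀ p ∈ P.minPairs t, g p = h p) :
    P.minSum g = P.minSum h := by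
  unfold minSum
  refine Finset.sum_congr rfl fun t _ => ?_
  congr 1
  exact Finset.sum_congr rfl fun p hp => by rw [H t p hp]

theorem minSum_add (g h : ℕ × ℕ → ℝ) :
    P.minSum (fun p => g p + h p) = P.minSum g + P.minSum h := by
  simp only [minSum, mul_add, Finset.sum_add_distrib]

theorem minSum_const_mul (a : ℝ) (g : ℕ × ℕ → ℝ) :
    P.minSum (fun p => a * g p) = a * P.minSum g := by
  simp only [minSum, Finset.mul_sum]
  exact Finset.sum_congr rfl fun t _ => Finset.sum_congr rfl fun p _ => by ring

/-- On minimal pairs `j = ψ + i T`. This relation between `Q1`, `Q2` and the plain sum produces the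
constants of the expansion in both bounds. -/
theorem minSum_eq_psi_add (g : ℕ × ℕ → ℝ) :
    P.minSum (fun p => p.2 * g p) = P.psi * P.minSum g + P.T * P.minSum fun p => p.1 * g p := by
  rw [← minSum_const_mul, ← minSum_const_mul, ← minSum_add]
  refine minSum_congr fun t p hp => ?_
  rw [(mem_minPairs.1 hp).2]
  ring

theorem coeff_pos {t : Fin nv} {p : ℕ × ℕ} (hp : p ∈ P.minPairs t) :
    (0 : ℝ) < (P.lam t : ℝ) / (P.var t).len * (P.var t).iowefCoeff p.1 p.2 := by
  have h1 : (0 : ℝ) < P.lam t := by exact_mod_cast P.lam_pos t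
  have h2 : (0 : ℝ) < (P.var t).len := by exact_mod_cast (P.var t).len_pos
  have h3 : (0 : ℝ) < (P.var t).iowefCoeff p.1 p.2 := by
    exact_mod_cast (VarType.of_mem_monomials (mem_minPairs.1 hp).1).2.2
  positivity

theorem minSum_eq (g : ℕ × ℕ → ℝ) : P.minSum g = ∑ t, ∑ p ∈ P.minPairs t,
    (P.lam t : ℝ) / (P.var t).len * (P.var t).iowefCoeff p.1 p.2 * g p := by
  simp only [minSum, Finset.mul_sum, mul_assoc]

theorem minSum_mono {g h : ℕ × ℕ → ℝ} (H : ∀ t, ∀ p ∈ P.minPairs t, g p ≤ h p) :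
    P.minSum g ≤ P.minSum h := by
  rw [minSum_eq, minSum_eq]
  exact Finset.sum_le_sum fun t _ => Finset.sum_le_sum fun p hp =>
    mul_le_mul_of_nonneg_left (H t p hp) (coeff_pos hp).le

theorem minSum_lt {g h : ℕ × ℕ → ℝ} (H : ∀ t, ∀ p ∈ P.minPairs t, g p < h p) :
    P.minSum g < P.minSum h := by
  rw [minSum_eq, minSum_eq]
  obtain ⟨t₀, p₀, hp₀⟩ := P.exists_mem_minPairs
  refine Finset.sum_lt_sum (fun t _ => Finset.sum_le_sum fun p hp =>
    mul_le_mul_of_nonneg_left (H t p hp).le (coeff_pos hp).le) ⟨t₀, Finset.mem_univ _, ?_⟩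
  exact Finset.sum_lt_sum_of_nonempty ⟨p₀, hp₀⟩ fun p hp =>
    mul_lt_mul_of_pos_left (H t₀ p hp) (coeff_pos hp)

theorem minSum_pos {g : ℕ × ℕ → ℝ} (H : ∀ t, ∀ p ∈ P.minPairs t, 0 < g p) : 0 < P.minSum g := by
  have := minSum_lt H
  simpa [minSum] using this

theorem pos_of_mem_minPairs {t : Fin nv} {p : ℕ × ℕ} (hp : p ∈ P.minPairs t) :
    1 ≤ p.1 ∧ 2 ≤ p.2 :=
  let h := VarType.of_mem_monomials (mem_minPairs.1 hp).1
  ⟨h.1, h.2.1⟩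

variable (P)

theorem minTerm_eq_mul_pow (x : ℝ) (p : ℕ × ℕ) : P.minTerm x p = P.minTerm 1 p * x ^ p.1 := by
  simp [minTerm]

theorem minTerm_pos {x : ℝ} (hx : 0 < x) (p : ℕ × ℕ) : 0 < P.minTerm x p := by
  have h1 := P.C_pos
  have h2 := P.intLam_pos'
  unfold minTerm
  positivity

theorem continuous_Q1 : Continuous P.Q1 := by
  unfold Q1
  fun_prop

theorem strictMonoOn_Q1 : StrictMonoOn P.Q1 (Set.Ici 0) := by
  intro x hx y _ hxy
  rw [Q1_eq, Q1_eq]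
  refine minSum_lt fun t p hp => ?_
  obtain ⟨h1, h2⟩ := pos_of_mem_minPairs hp
  have h3 : (0 : ℝ) < p.2 := by exact_mod_cast (by omega : 0 < p.2)
  rw [P.minTerm_eq_mul_pow x, P.minTerm_eq_mul_pow y]
  have := P.minTerm_pos one_pos p
  have := pow_lt_pow_left₀ hxy hx (by omega : p.1 ≠ 0)
  gcongr

theorem Q1_zero : P.Q1 0 = 0 := by
  rw [Q1_eq, minSum_congr (h := fun _ => 0)]
  · simp [minSum]
  · intro t p hp
    obtain ⟨h1, h2⟩ := pos_of_mem_minPairs hp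
    simp [minTerm, zero_pow (by omega : p.1 ≠ 0)]

theorem bijOn_Q1 : Set.BijOn P.Q1 (Set.Ici 0) (Set.Ici 0) := by
  refine ⟨fun x hx => ?_, P.strictMonoOn_Q1.injOn, fun y hy => ?_⟩
  · rw [Set.mem_Ici, ← P.Q1_zero]
    exact P.strictMonoOn_Q1.monotoneOn (by simp) hx hx
  · have h1 : 0 < P.Q1 1 := by
      rw [← P.Q1_zero]
      exact P.strictMonoOn_Q1 (by simp) (by simp) one_pos
    -- All monomials have positive degree, so `Q₁(X) ≥ X * Q₁(1)` for `X ≥ 1`. This choice makes the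
    -- right side at least `y`.
    set X := y / P.Q1 1 + 1
    have hX : 1 ≤ X := by
      have : 0 ≤ y / P.Q1 1 := div_nonneg hy h1.le
      linarith
    have h2 : y ≤ P.Q1 X := by
      have h3 : X * P.Q1 1 ≤ P.Q1 X := by
        rw [Q1_eq, Q1_eq, ← minSum_const_mul]
        refine minSum_mono fun t p hp => ?_
        obtain ⟨h1, h2⟩ := pos_of_mem_minPairs hp
        rw [P.minTerm_eq_mul_pow X]
        have h4 : X ≤ X ^ p.1 := le_self_pow₀ hX (by omega)
        have h5 := mul_le_mul_of_nonneg_left h4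
          (mul_nonneg (Nat.cast_nonneg p.2) (P.minTerm_pos one_pos p).le)
        linarith
      refine le_trans ?_ h3
      simp only [X, add_mul, div_mul_cancel₀ _ h1.ne']
      linarith
    obtain ⟨x, hx, hxy⟩ := intermediate_value_Icc (by linarith : (0 : ℝ) ≤ X)
      P.continuous_Q1.continuousOn ⟨by rw [P.Q1_zero]; exact hy, h2⟩
    exact ⟨x, hx.1, hxy⟩

theorem Q1_Q1inv : P.Q1 (P.Q1inv 1) = 1 :=
  Function.invFunOn_eq (P.bijOn_Q1.surjOn (by simp : (1 : ℝ) ∈ Set.Ici 0))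

theorem Q1inv_pos : 0 < P.Q1inv 1 := by
  have h : P.Q1inv 1 ∈ Set.Ici 0 :=
    Function.invFunOn_mem (P.bijOn_Q1.surjOn (by simp : (1 : ℝ) ∈ Set.Ici 0))
  refine lt_of_le_of_ne h fun h0 => ?_
  have := P.Q1_Q1inv
  rw [← h0, P.Q1_zero] at this
  exact zero_ne_one this

theorem Q2_pos : 0 < P.Q2 (P.Q1inv 1) := by
  rw [Q2_eq]
  refine minSum_pos fun t p hp => ?_
  have h1 : (0 : ℝ) < p.1 := by exact_mod_cast (pos_of_mem_minPairs hp).1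
  exact mul_pos h1 (P.minTerm_pos P.Q1inv_pos p)

/-! ### The upper bound -/

open Real in
-- The Chernoff bound for the character `(w, d) ↦ x^w * y^d`. The zero word contributes the `1` in
-- each factor, and `log (1 + u) ≤ u` linearizes.
theorem log_varConfig_le {n w d : ℕ} (hn : P.Realizable n)
    (h : 0 < configCount P.varWeight (P.varCount n) (w, d)) {x y : ℝ} (hx : 0 < x) (hy : 0 < y) :
    log (configCount P.varWeight (P.varCount n) (w, d)) ≤ P.edgeCount n *
      (∑ t, (P.lam t : ℝ) / (P.var t).len *
        ∑ p ∈ (P.var t).monomials, (P.var t).iowefCoeff p.1 p.2 * (x ^ p.1 * y ^ p.2))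
      - w * log x - d * log y := by
  let φ : Multiplicative (ℕ × ℕ) →* ℝ :=
    { toFun := fun p => x ^ p.toAdd.1 * y ^ p.toAdd.2
      map_one' := by simp
      map_mul' := fun a b => by simp only [toAdd_mul, Prod.fst_add, Prod.snd_add, pow_add]; ring }
  have h1 := configCount_mul_le_prod P.varWeight (P.varCount n) (w, d) φ
    (fun a => by simp only [φ, MonoidHom.coe_mk, OneHom.coe_mk]; positivity)
  have h2 : ∀ t, ∑ z, φ (.ofAdd (P.varWeight t z)) = 1 +
      ∑ p ∈ (P.var t).monomials, (P.var t).iowefCoeff p.1 p.2 * (x ^ p.1 * y ^ p.2) := by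
    intro t
    rw [← VarType.sum_words (P.var t) fun p => x ^ p.1 * y ^ p.2,
      ← Finset.add_sum_erase _ _ (Finset.mem_univ (0 : Fin (P.var t).dim → ZMod 2))]
    simp [φ, varWeight]
  simp_rw [h2] at h1
  have hc : (0 : ℝ) < configCount P.varWeight (P.varCount n) (w, d) := by exact_mod_cast h
  have hpos : ∀ t, 0 < 1 +
      ∑ p ∈ (P.var t).monomials, (P.var t).iowefCoeff p.1 p.2 * (x ^ p.1 * y ^ p.2) :=
    fun t => by positivity
  have h3 : φ (.ofAdd (w, d)) = x ^ w * y ^ d := rfl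
  rw [h3] at h1
  have h4 := log_le_log (by positivity) h1
  rw [log_prod (fun t _ => (pow_pos (hpos t) _).ne'), log_mul hc.ne' (by positivity),
    log_mul (by positivity) (by positivity), log_pow, log_pow] at h4
  have h5 : ∑ t, log ((1 + ∑ p ∈ (P.var t).monomials,
        (P.var t).iowefCoeff p.1 p.2 * (x ^ p.1 * y ^ p.2)) ^ P.varCount n t) ≤
      P.edgeCount n * ∑ t, (P.lam t : ℝ) / (P.var t).len *
        ∑ p ∈ (P.var t).monomials, (P.var t).iowefCoeff p.1 p.2 * (x ^ p.1 * y ^ p.2) := by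
    rw [Finset.mul_sum]
    refine Finset.sum_le_sum fun t _ => ?_
    rw [log_pow, ← mul_assoc, hn.edgeCount_cast, ← hn.varCount_cast]
    refine mul_le_mul_of_nonneg_left ?_ (by positivity)
    have := log_le_sub_one_of_pos (hpos t)
    linarith
  linarith

open Real in
theorem log_chkConfig_le {n d : ℕ} (hn : P.Realizable n)
    (h : 0 < configCount P.chkWeight (P.chkCount n) d) {z : ℝ} (hz : 0 < z) :
    log (configCount P.chkWeight (P.chkCount n) d) ≤ P.edgeCount n *
      (∑ t, (P.rho t : ℝ) / (P.chk t).len *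
        ∑ c ∈ Finset.univ.erase (0 : (P.chk t).code), z ^ P.chkWeight t c) - d * log z := by
  let φ : Multiplicative ℕ →* ℝ :=
    { toFun := fun p => z ^ p.toAdd
      map_one' := by simp
      map_mul' := fun a b => by simp only [toAdd_mul, pow_add] }
  have h1 := configCount_mul_le_prod P.chkWeight (P.chkCount n) d φ
    (fun a => by simp only [φ, MonoidHom.coe_mk, OneHom.coe_mk]; positivity)
  have h2 : ∀ t, ∑ c, φ (.ofAdd (P.chkWeight t c)) = 1 +
      ∑ c ∈ Finset.univ.erase (0 : (P.chk t).code), z ^ P.chkWeight t c := by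
    intro t
    rw [← Finset.add_sum_erase _ _ (Finset.mem_univ (0 : (P.chk t).code))]
    simp [φ, chkWeight]
  simp_rw [h2] at h1
  have hc : (0 : ℝ) < configCount P.chkWeight (P.chkCount n) d := by exact_mod_cast h
  have hpos : ∀ t, 0 < 1 +
      ∑ c ∈ Finset.univ.erase (0 : (P.chk t).code), z ^ P.chkWeight t c :=
    fun t => by positivity
  have h3 : φ (.ofAdd d) = z ^ d := rfl
  rw [h3] at h1
  have h4 := log_le_log (by positivity) h1
  rw [log_prod (fun t _ => (pow_pos (hpos t) _).ne'), log_mul hc.ne' (by positivity),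
    log_pow] at h4
  have h5 : ∑ t, log ((1 + ∑ c ∈ Finset.univ.erase (0 : (P.chk t).code),
        z ^ P.chkWeight t c) ^ P.chkCount n t) ≤
      P.edgeCount n * ∑ t, (P.rho t : ℝ) / (P.chk t).len *
        ∑ c ∈ Finset.univ.erase (0 : (P.chk t).code), z ^ P.chkWeight t c := by
    rw [Finset.mul_sum]
    refine Finset.sum_le_sum fun t _ => ?_
    rw [log_pow, ← mul_assoc, hn.edgeCount_cast, ← hn.chkCount_cast]
    refine mul_le_mul_of_nonneg_left ?_ (by positivity)
    have := log_le_sub_one_of_pos (hpos t)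
    linarith
  linarith

theorem card_chkWeight_eq (t : Fin nc) (u : ℕ) :
    ({c : (P.chk t).code | P.chkWeight t c = u} : Finset _).card = (P.chk t).wefCoeff u := by
  rw [CheckType.wefCoeff, ← Fintype.card_subtype, ← Nat.card_eq_fintype_card]
  exact Nat.card_congr (Equiv.subtypeSubtypeEquivSubtypeInter
    (fun x => x ∈ (P.chk t).code) (fun x => hammingNorm x = u))

theorem r_le_chkWeight {t : Fin nc} {c : (P.chk t).code} (hc : c ≠ 0) : P.r ≤ P.chkWeight t c :=
  (P.r_le t).trans (minDist_le c.2 fun h => hc (Subtype.ext h))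

/-- A check type of larger minimum distance has no codeword of weight `r`, so the restriction on the
types in `C` is immaterial. -/
theorem sum_rho_wefCoeff :
    ∑ t, (P.rho t : ℝ) / (P.chk t).len * (P.chk t).wefCoeff P.r = P.C / P.r := by
  have hr : (P.r : ℝ) ≠ 0 := by have := P.two_le_r_cast; linarith
  rw [C, mul_div_cancel_left₀ _ hr]
  symm
  refine (Finset.sum_subset (Finset.subset_univ _) fun t _ ht => ?_).trans
    (Finset.sum_congr rfl fun t _ => by ring)
  have h0 : (P.chk t).wefCoeff P.r = 0 := by
    rw [← card_chkWeight_eq, Finset.card_eq_zero, Finset.filter_eq_empty_iff]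
    intro c _ hc
    have hc0 : c ≠ 0 := by
      rintro rfl
      have := P.two_le_r
      simp [chkWeight] at hc
      omega
    have h1 : minDist (P.chk t).code ≤ P.r := by
      rw [← hc]
      exact minDist_le c.2 fun h => hc0 (Subtype.ext h)
    exact ht (by simp [le_antisymm h1 (P.r_le t)])
  simp [h0]

/-- The coefficient of the error term in `sum_chk_le`. -/
def chkErr : ℝ := ∑ t, (P.rho t : ℝ) / (P.chk t).len * Fintype.card (P.chk t).code

/-- Nonzero codewords of weight other than `r` have weight at least `r + 1`, and `z ≤ 1`. -/
theorem sum_chk_le {z : ℝ} (hz : 0 < z) (hz1 : z ≤ 1) :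
    ∑ t, (P.rho t : ℝ) / (P.chk t).len *
        ∑ c ∈ Finset.univ.erase (0 : (P.chk t).code), z ^ P.chkWeight t c
      ≤ P.C / P.r * z ^ P.r + P.chkErr * z ^ (P.r + 1) := by
  rw [← sum_rho_wefCoeff, chkErr, Finset.sum_mul, Finset.sum_mul, ← Finset.sum_add_distrib]
  refine Finset.sum_le_sum fun t _ => ?_
  have h1 : (0 : ℝ) < P.rho t := by exact_mod_cast P.rho_pos t
  rw [mul_assoc, mul_assoc, ← mul_add]
  refine mul_le_mul_of_nonneg_left ?_ (by positivity)
  have h2 : ∀ c ∈ Finset.univ.erase (0 : (P.chk t).code), z ^ P.chkWeight t c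
      ≤ (if P.chkWeight t c = P.r then z ^ P.r else 0) + z ^ (P.r + 1) := by
    intro c hc
    have h3 := P.r_le_chkWeight (Finset.ne_of_mem_erase hc)
    split_ifs with h4
    · rw [h4]
      have : 0 < z ^ (P.r + 1) := by positivity
      linarith
    · rw [zero_add]
      exact pow_le_pow_of_le_one hz.le hz1 (by omega)
  refine (Finset.sum_le_sum h2).trans ?_
  have h5 := Finset.sum_le_sum_of_subset_of_nonneg
    (Finset.erase_subset (0 : (P.chk t).code) Finset.univ)
    (f := fun c => (if P.chkWeight t c = P.r then z ^ P.r else 0) + z ^ (P.r + 1))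
    (fun c _ _ => by positivity)
  refine h5.trans (le_of_eq ?_)
  rw [Finset.sum_add_distrib, Finset.sum_const, ← Finset.sum_filter, Finset.sum_const,
    card_chkWeight_eq, Finset.card_univ, nsmul_eq_mul, nsmul_eq_mul]

/-- The part of the Chernoff bound for the variable nodes that comes from the pairs that do not
achieve the minimum `T`. -/
def varErr (δ : ℝ) : ℝ := ∑ t, (P.lam t : ℝ) / (P.var t).len *
  ∑ p ∈ (P.var t).monomials \ P.minPairs t, (P.var t).iowefCoeff p.1 p.2 *
    (P.minTerm (P.Q1inv 1) p * δ ^ (((p.2 : ℝ) - p.1 * P.T) / P.psi))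

theorem rpow_isLittleO_id {a : ℝ} (ha : 1 < a) :
    (fun δ : ℝ => δ ^ a) =o[𝓝[>] 0] (fun δ => δ) := by
  have h1 : Tendsto (fun δ : ℝ => δ ^ (a - 1)) (𝓝[>] 0) (𝓝 0) := by
    have := (Real.continuousAt_rpow_const 0 (a - 1) (Or.inr (by linarith))).tendsto
    rw [Real.zero_rpow (by linarith)] at this
    exact this.mono_left nhdsWithin_le_nhds
  refine (isLittleO_iff_tendsto' ?_).2 (h1.congr' ?_)
  · filter_upwards [self_mem_nhdsWithin] with δ hδ h0
    exact absurd h0 (ne_of_gt hδ)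
  · filter_upwards [self_mem_nhdsWithin] with δ hδ
    rw [Real.rpow_sub hδ, Real.rpow_one]

/-- For a pair that is not minimal, `j > ψ + i T`, so the exponent of `δ` exceeds one. -/
theorem varErr_isLittleO : P.varErr =o[𝓝[>] 0] (fun δ : ℝ => δ) := by
  unfold varErr
  refine IsLittleO.fun_sum fun t _ => ?_
  refine IsLittleO.const_mul_left ?_ _
  refine IsLittleO.fun_sum fun p hp => ?_
  refine ((rpow_isLittleO_id ?_).const_mul_left _).const_mul_left _
  rw [Finset.mem_sdiff, mem_minPairs] at hp
  have h1 := P.psi_add_mul_T_le hp.1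
  have h2 : P.psi + p.1 * P.T ≠ p.2 := fun h => hp.2 ⟨hp.1, h.symm⟩
  have h3 := lt_of_le_of_ne h1 h2
  rw [lt_div_iff₀ P.psi_pos]
  linarith

/-- With these parameters a monomial becomes `minTerm` times `δ^((j - iT)/ψ)`, which is linear in
`δ` on the minimal pairs. The factor `e / ∫λ` in the first parameter produces the coefficients of
`Q1` and `Q2`. -/
theorem sum_var_eq {δ : ℝ} (hδ : 0 < δ) :
    ∑ t, (P.lam t : ℝ) / (P.var t).len * ∑ p ∈ (P.var t).monomials,
        (P.var t).iowefCoeff p.1 p.2 *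
          (((Real.exp 1 * δ / P.intLam) ^ (-(P.T / P.psi)) * P.Q1inv 1) ^ p.1 *
            (P.C ^ (1 / P.r : ℝ) * δ ^ (1 / P.psi)) ^ p.2)
      = δ * P.minSum (P.minTerm (P.Q1inv 1)) + P.varErr δ := by
  have hL := P.intLam_pos'
  have hC := P.C_pos
  have hψ := P.psi_pos
  have h1 : ∀ p : ℕ × ℕ, ((Real.exp 1 * δ / P.intLam) ^ (-(P.T / P.psi)) * P.Q1inv 1) ^ p.1 *
      (P.C ^ (1 / P.r : ℝ) * δ ^ (1 / P.psi)) ^ p.2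
      = P.minTerm (P.Q1inv 1) p * δ ^ (((p.2 : ℝ) - p.1 * P.T) / P.psi) := by
    intro p
    have h2 : Real.exp 1 * δ / P.intLam = δ / (P.intLam / Real.exp 1) := by
      field_simp
    have h3 : ((Real.exp 1 * δ / P.intLam) ^ (-(P.T / P.psi))) ^ p.1
        = (P.intLam / Real.exp 1 : ℝ) ^ ((p.1 : ℝ) * P.T / P.psi) *
          δ ^ (-(p.1 * P.T / P.psi)) := by
      rw [h2, ← Real.rpow_natCast, ← Real.rpow_mul (by positivity),
        Real.div_rpow hδ.le (by positivity)]
      rw [show -(P.T / P.psi) * (p.1 : ℝ) = -(p.1 * P.T / P.psi) by ring,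
        Real.rpow_neg (by positivity) (p.1 * P.T / P.psi) (x := (P.intLam / Real.exp 1 : ℝ)),
        div_inv_eq_mul, mul_comm]
    have h4 : (P.C ^ (1 / P.r : ℝ)) ^ p.2 = P.C ^ ((p.2 : ℝ) / P.r) := by
      rw [← Real.rpow_natCast, ← Real.rpow_mul hC.le]
      congr 1; ring
    have h5 : (δ ^ (1 / P.psi)) ^ p.2 = δ ^ ((p.2 : ℝ) / P.psi) := by
      rw [← Real.rpow_natCast, ← Real.rpow_mul hδ.le]
      congr 1; ring
    have h6 : δ ^ (((p.2 : ℝ) - p.1 * P.T) / P.psi)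
        = δ ^ ((p.2 : ℝ) / P.psi) * δ ^ (-(p.1 * P.T / P.psi)) := by
      rw [← Real.rpow_add hδ]
      congr 1; ring
    rw [mul_pow, mul_pow, h3, h4, h5, h6, minTerm]
    ring
  simp_rw [h1]
  rw [← minSum_const_mul, minSum, varErr, ← Finset.sum_add_distrib]
  refine Finset.sum_congr rfl fun t _ => ?_
  rw [← mul_add]
  congr 1
  have hsub : P.minPairs t ⊆ (P.var t).monomials := fun p hp => (mem_minPairs.1 hp).1
  rw [← Finset.sum_sdiff hsub, add_comm]
  congr 1
  refine Finset.sum_congr rfl fun p hp => ?_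
  have h7 : ((p.2 : ℝ) - p.1 * P.T) / P.psi = 1 := by
    rw [(mem_minPairs.1 hp).2, add_sub_cancel_right, div_self hψ.ne']
  rw [h7, Real.rpow_one]
  ring

/-- The total relative error of the upper bound for a summand with `δ E` ones on the edges. -/
def upperErr (δ : ℝ) : ℝ :=
  P.varErr δ + P.chkErr * ((δ / P.C) ^ (1 / P.r : ℝ)) ^ (P.r + 1) + δ ^ 2

theorem upperErr_isLittleO : P.upperErr =o[𝓝[>] 0] (fun δ : ℝ => δ) := by
  have hr := P.two_le_r_cast
  have hC := P.C_pos
  refine (P.varErr_isLittleO.add ?_).add ?_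
  · refine IsLittleO.const_mul_left ?_ _
    -- The check error `z^(r+1)` is of order `δ^((r+1)/r)`.
    have ha : (1 : ℝ) < (1 / P.r : ℝ) * ((P.r + 1 : ℕ) : ℝ) := by
      push_cast
      rw [one_div_mul_eq_div, lt_div_iff₀] <;> linarith
    refine ((rpow_isLittleO_id ha).const_mul_left
      ((P.C ^ ((1 / P.r : ℝ) * ((P.r + 1 : ℕ) : ℝ)))⁻¹)).congr' ?_ EventuallyEq.rfl
    filter_upwards [self_mem_nhdsWithin] with δ hδ
    have hδ' : (0 : ℝ) < δ := hδ
    rw [← Real.rpow_natCast, ← Real.rpow_mul (by positivity), Real.div_rpow hδ'.le hC.le]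
    ring
  · have := rpow_isLittleO_id (a := 2) (by norm_num)
    simpa using this

open Real in
-- The right side involves `δ` only through the error: the dependence on the number of ones on the
-- edges is maximized out, so no further optimization over `d` is needed.
theorem log_expTerm_le {n w d : ℕ} (hn : P.Realizable n) (h : 0 < P.expTerm n w d) {a δ : ℝ}
    (hw : (w : ℝ) = P.edgeCount n * a) (hd : (d : ℝ) = P.edgeCount n * δ)
    (ha : 0 < a) (hδ : 0 < δ) (hδ1 : δ < 1) (hδC : δ ≤ P.C) :
    log (P.expTerm n w d) ≤ P.edgeCount n *
      (P.T / P.psi * (a * log (a / (P.intLam * P.Q2 (P.Q1inv 1)))) - a * log (P.Q1inv 1)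
        + P.upperErr δ) + 2 * log (P.edgeCount n) + 2 := by
  have hL := P.intLam_pos'
  have hC := P.C_pos
  have hψ := P.psi_pos
  have hr := P.two_le_r_cast
  have hx0 := P.Q1inv_pos
  have hQ2 := P.Q2_pos
  have hn0 : (0 : ℝ) < n := by exact_mod_cast hn.1
  have hE0 : (0 : ℝ) < P.edgeCount n := by rw [hn.edgeCount_cast]; positivity
  obtain ⟨hv, hc, hdE⟩ := expTerm_pos_iff.1 h
  have hd0 : 0 < d := by
    have : (0 : ℝ) < d := by rw [hd]; positivity
    exact_mod_cast this
  have hdE' : d < P.edgeCount n := by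
    have : (d : ℝ) < P.edgeCount n := by rw [hd]; nlinarith
    exact_mod_cast this
  -- The value of `z` solves `C * z ^ r = δ`, the stationarity condition of the leading check term,
  -- and `y = δ / z`. The power of `δ` in `x` makes minimal monomials linear in `δ`.
  set x := (exp 1 * δ / P.intLam) ^ (-(P.T / P.psi)) * P.Q1inv 1 with hx
  set y := P.C ^ (1 / P.r : ℝ) * δ ^ (1 / P.psi) with hy
  set z := (δ / P.C) ^ (1 / P.r : ℝ) with hz
  have hxpos : 0 < x := by positivity
  have hypos : 0 < y := by positivity
  have hzpos : 0 < z := by positivity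
  have hz1 : z ≤ 1 := rpow_le_one (by positivity) ((div_le_one hC).2 hδC) (by positivity)
  have h1 := P.log_varConfig_le hn hv hxpos hypos
  rw [P.sum_var_eq hδ] at h1
  have h2 := P.log_chkConfig_le hn hc hzpos
  have h3 := mul_le_mul_of_nonneg_left (P.sum_chk_le hzpos hz1) hE0.le
  have h4 := le_log_choose_quadratic hdE' hd0 hd
  have hzr : P.C / P.r * z ^ P.r = δ / P.r := by
    rw [hz, ← rpow_natCast, ← rpow_mul (by positivity), one_div_mul_cancel (by linarith),
      rpow_one]
    field_simp
  have hlogyz : log y + log z = log δ := by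
    rw [hy, hz, log_mul (by positivity) (by positivity), log_rpow hC, log_rpow hδ,
      log_rpow (by positivity), log_div hδ.ne' hC.ne', P.inv_psi]
    ring
  have hlogx : log x = -(P.T / P.psi) * (1 + log δ - log P.intLam) + log (P.Q1inv 1) := by
    rw [hx, log_mul (by positivity) hx0.ne', log_rpow (by positivity),
      log_div (by positivity) hL.ne', log_mul (exp_pos 1).ne' hδ.ne', log_exp]
  -- The coefficient of `δ`: variable nodes, check nodes and the binomial coefficient contribute one
  -- term each. Here `Q₁(x₀) = 1` enters.
  have hG : P.minSum (P.minTerm (P.Q1inv 1)) + 1 / P.r - 1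
      = -(P.T / P.psi) * P.Q2 (P.Q1inv 1) := by
    have h5 := minSum_eq_psi_add (P := P) (P.minTerm (P.Q1inv 1))
    rw [← P.Q1_eq, ← P.Q2_eq, P.Q1_Q1inv] at h5
    have h6 := P.inv_psi
    have h7 : P.minSum (P.minTerm (P.Q1inv 1)) = 1 / P.psi - P.T / P.psi * P.Q2 (P.Q1inv 1) := by
      field_simp
      linarith
    linarith
  -- The left side is concave in `δ` with maximum at `δ = a / Q₂(x₀)`; the tangent bound `log t ≤ t
  -- - 1` at `t = δ Q₂(x₀) / a` suffices.
  have hkey : a * (1 + log δ - log P.intLam) - P.Q2 (P.Q1inv 1) * δ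
      ≤ a * log (a / (P.intLam * P.Q2 (P.Q1inv 1))) := by
    have h8 := log_le_sub_one_of_pos (x := δ * P.Q2 (P.Q1inv 1) / a) (by positivity)
    rw [log_div (by positivity) ha.ne', log_mul hδ.ne' hQ2.ne'] at h8
    rw [log_div ha.ne' (by positivity), log_mul hL.ne' hQ2.ne']
    have h9 := mul_le_mul_of_nonneg_left h8 ha.le
    have h10 : a * (δ * P.Q2 (P.Q1inv 1) / a - 1) = δ * P.Q2 (P.Q1inv 1) - a := by
      field_simp
    linarith
  have hTψ : 0 ≤ P.T / P.psi := div_nonneg P.T_nonneg hψ.le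
  have hkey' := mul_le_mul_of_nonneg_left hkey hTψ
  have hexp : log (P.expTerm n w d) = log (configCount P.varWeight (P.varCount n) (w, d)) +
      log (configCount P.chkWeight (P.chkCount n) d) - log ((P.edgeCount n).choose d) := by
    have := Nat.choose_pos hdE
    unfold expTerm
    rw [log_div (by positivity) (by positivity), log_mul (by positivity) (by positivity)]
  rw [hexp]
  rw [hzr] at h3
  have hd5 : (d : ℝ) * log y = P.edgeCount n * δ * log δ - d * log z := by
    rw [← hlogyz, ← hd]; ring
  rw [hd5, hlogx, hw] at h1
  have hEkey := mul_le_mul_of_nonneg_left hkey' hE0.le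
  unfold upperErr
  rw [← hz]
  have hGδ : P.edgeCount n * (δ * P.minSum (P.minTerm (P.Q1inv 1)))
      = P.edgeCount n * δ * (1 - 1 / P.r - P.T / P.psi * P.Q2 (P.Q1inv 1)) := by
    have : P.minSum (P.minTerm (P.Q1inv 1)) = 1 - 1 / P.r - P.T / P.psi * P.Q2 (P.Q1inv 1) := by
      linarith
    rw [this]; ring
  have hr' : δ / P.r = δ * (1 / P.r) := by ring
  rw [hr'] at h3
  linarith

end Params

/-! ### The lower bound -/

open Real in
-- The multinomial estimate for every type. The reference state `o t` has weight zero and takes the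
-- remaining nodes, so it does not affect the total weight.
theorem le_log_configCount {ι : Type} [Fintype ι] {X : ι → Type} [∀ t, Fintype (X t)]
    [∀ t, DecidableEq (X t)] {M : Type} [AddCommMonoid M] (u : ∀ t, X t → M) (N : ι → ℕ)
    (hN : ∀ t, 0 < N t) (o : ∀ t, X t) (hu : ∀ t, u t (o t) = 0) (φ : ∀ t, X t → ℝ)
    (hσ : ∀ t, ∑ x ∈ Finset.univ.erase (o t), φ t x ≤ 1 / 2)
    (hint : ∀ t x, ∃ k : ℕ, (k : ℝ) = N t * φ t x) {E : ℕ} (hE : ∀ t, N t ≤ E) (s : M)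
    (hs : ∀ c : ∀ t, X t → ℕ, (∀ t x, (c t x : ℝ) = N t * φ t x) →
      ∑ t, ∑ x ∈ Finset.univ.erase (o t), c t x • u t x = s) :
    0 < configCount u N s ∧
      ∑ t, N t * (∑ x ∈ Finset.univ.erase (o t), φ t x * (1 - log (φ t x))
          - 2 * (∑ x ∈ Finset.univ.erase (o t), φ t x) ^ 2)
        - (∑ t, (Fintype.card (X t) : ℝ)) * (log E + 1) ≤ log (configCount u N s) := by
  choose c hc using hint
  have hcs := hs c hc
  -- The natural subtraction is not truncated: the other states use at most half of the nodes.
  let c' : ∀ t, X t → ℕ := fun t x =>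
    if x = o t then N t - ∑ x ∈ Finset.univ.erase (o t), c t x else c t x
  have hc'o : ∀ t, c' t (o t) = N t - ∑ x ∈ Finset.univ.erase (o t), c t x := fun t => if_pos rfl
  have hc' : ∀ t, ∀ x ∈ Finset.univ.erase (o t), c' t x = c t x := fun t x hx =>
    if_neg (Finset.ne_of_mem_erase hx)
  have hle : ∀ t, ∑ x ∈ Finset.univ.erase (o t), c t x ≤ N t := by
    intro t
    have h : ((∑ x ∈ Finset.univ.erase (o t), c t x : ℕ) : ℝ) ≤ N t := by
      push_cast
      simp_rw [hc, ← Finset.mul_sum]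
      have := mul_le_mul_of_nonneg_left (hσ t) (Nat.cast_nonneg (α := ℝ) (N t))
      have h0 : (0 : ℝ) ≤ N t := Nat.cast_nonneg _
      linarith
    exact_mod_cast h
  have hsum : ∀ t, ∑ x, c' t x = N t := by
    intro t
    rw [← Finset.add_sum_erase _ _ (Finset.mem_univ (o t)), hc'o,
      Finset.sum_congr rfl (hc' t), Nat.sub_add_cancel (hle t)]
  have hs' : ∑ t, ∑ x, c' t x • u t x = s := by
    rw [← hcs]
    refine Finset.sum_congr rfl fun t _ => ?_
    rw [← Finset.add_sum_erase _ _ (Finset.mem_univ (o t)), hu, smul_zero, zero_add]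
    exact Finset.sum_congr rfl fun x hx => by rw [hc' t x hx]
  have hmul := prod_multinomial_le_configCount u N s c' hsum hs'
  have hmpos : ∀ t, 0 < Nat.multinomial Finset.univ (c' t) := fun t => Nat.multinomial_pos _ _
  have hppos : 0 < ∏ t, Nat.multinomial Finset.univ (c' t) := Finset.prod_pos fun t _ => hmpos t
  refine ⟨hppos.trans_le hmul, ?_⟩
  refine le_trans ?_ (log_natCast_le hmul)
  push_cast
  rw [log_prod (fun t _ => by exact_mod_cast (hmpos t).ne'), Finset.sum_mul,
    ← Finset.sum_sub_distrib]
  refine Finset.sum_le_sum fun t _ => ?_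
  have h1 := le_log_multinomial (c' t) (o t) (φ t) (hsum t) (hN t)
    (fun x hx => by rw [hc' t x (by simp [hx]), hc]) (hσ t)
  refine le_trans ?_ h1
  have h2 := log_natCast_le (hE t)
  gcongr

theorem exists_common_denominator {κ : Type} [Fintype κ] (f : κ → ℚ) (hf : ∀ i, 0 ≤ f i) :
    ∃ D : ℕ, 0 < D ∧ ∀ k i, ∃ m : ℕ, ((k * D : ℕ) : ℚ) * f i = m := by
  refine ⟨∏ i, (f i).den, Finset.prod_pos fun i _ => (f i).den_pos, fun k i => ?_⟩
  obtain ⟨e, he⟩ := Finset.dvd_prod_of_mem (fun i => (f i).den) (Finset.mem_univ i)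
  refine ⟨k * e * (f i).num.toNat, ?_⟩
  rw [he]
  have h1 : (((f i).num.toNat : ℤ) : ℚ) = (f i).num := by
    rw [Int.toNat_of_nonneg (Rat.num_nonneg.2 (hf i))]
  have h2 : ((f i).den : ℚ) * f i = (f i).num := Rat.den_mul_eq_num _
  push_cast at h1 ⊢
  rw [h1, ← h2]
  ring

namespace Params

variable {nc nv : ℕ} (P : Params nc nv)

theorem sum_words_minPairs (t : Fin nv) (G : ℕ × ℕ → ℝ) [DecidablePred (· ∈ P.minPairs t)] :
    ∑ x ∈ Finset.univ.erase (0 : Fin (P.var t).dim → ZMod 2),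
        (if P.varWeight t x ∈ P.minPairs t then G (P.varWeight t x) else 0)
      = ∑ p ∈ P.minPairs t, (P.var t).iowefCoeff p.1 p.2 * G p := by
  have h1 := VarType.sum_words (P.var t) (fun p => if p ∈ P.minPairs t then G p else 0)
  refine h1.trans ?_
  have hsub : P.minPairs t ⊆ (P.var t).monomials := fun p hp => (mem_minPairs.1 hp).1
  rw [← Finset.sum_subset hsub]
  · exact Finset.sum_congr rfl fun p hp => by rw [if_pos hp]
  · intro p _ hp
    rw [if_neg hp, mul_zero]

theorem sum_codewords_minWeight (t : Fin nc) (v : ℝ) :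
    ∑ c ∈ Finset.univ.erase (0 : (P.chk t).code), (if P.chkWeight t c = P.r then v else 0)
      = (P.chk t).wefCoeff P.r * v := by
  have h0 : P.chkWeight t 0 ≠ P.r := by
    have := P.two_le_r
    simp only [chkWeight, ZeroMemClass.coe_zero, hammingNorm_zero]
    omega
  rw [← card_chkWeight_eq, ← nsmul_eq_mul, ← Finset.sum_const, Finset.sum_filter]
  exact Finset.sum_erase _ (if_neg h0)

theorem exists_rat_minSum (g : ℕ × ℕ → ℚ) : ∃ q : ℚ, (q : ℝ) = P.minSum fun p => (g p : ℝ) := by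
  refine ⟨∑ t, P.lam t / (P.var t).len *
    ∑ p ∈ P.minPairs t, (P.var t).iowefCoeff p.1 p.2 * g p, ?_⟩
  unfold minSum
  push_cast
  rfl

theorem exists_rat_C : ∃ q : ℚ, (q : ℝ) = P.C := by
  refine ⟨P.r * ∑ t with minDist (P.chk t).code = P.r,
    P.rho t * (P.chk t).wefCoeff P.r / (P.chk t).len, ?_⟩
  unfold C
  push_cast
  rfl

/-- The exponent (per edge) of the number of configurations in which the variable nodes have local
words in the proportions `s θ` and all check nodes have local codewords of weight `r` or zero. -/
def lowerRate (θ : ℕ × ℕ → ℝ) (s : ℝ) : ℝ :=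
  P.minSum (fun p => s * θ p * (1 - Real.log (s * θ p)))
    + s * P.minSum (fun p => p.2 * θ p) / P.r *
        (1 - Real.log (s * P.minSum (fun p => p.2 * θ p) / P.C))
    - s * P.minSum (fun p => p.2 * θ p) * (1 - Real.log (s * P.minSum fun p => p.2 * θ p))

theorem varCount_pos {n : ℕ} (hn : P.Realizable n) (t : Fin nv) : 0 < P.varCount n t := by
  have h0 : (0 : ℝ) < n := by exact_mod_cast hn.1
  have h1 : (0 : ℝ) < P.lam t := by exact_mod_cast P.lam_pos t
  have h2 : (0 : ℝ) < (P.var t).len := by exact_mod_cast (P.var t).len_pos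
  have h3 := P.intLam_pos'
  have : (0 : ℝ) < P.varCount n t := by rw [hn.varCount_cast]; positivity
  exact_mod_cast this

theorem chkCount_pos {n : ℕ} (hn : P.Realizable n) (t : Fin nc) : 0 < P.chkCount n t := by
  have h0 : (0 : ℝ) < n := by exact_mod_cast hn.1
  have h1 : (0 : ℝ) < P.rho t := by exact_mod_cast P.rho_pos t
  have h2 : (0 : ℝ) < (P.chk t).len := by exact_mod_cast (P.chk t).len_pos
  have h3 := P.intLam_pos'
  have : (0 : ℝ) < P.chkCount n t := by rw [hn.chkCount_cast]; positivity
  exact_mod_cast this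

theorem chkCount_le {n : ℕ} (t : Fin nc) : P.chkCount n t ≤ P.edgeCount n :=
  (Nat.le_mul_of_pos_right _ (P.chk t).len_pos).trans
    (Finset.single_le_sum (f := fun t => P.chkCount n t * (P.chk t).len) (by simp)
      (Finset.mem_univ t))

theorem varCount_le {n : ℕ} (hn : P.Realizable n) (t : Fin nv) :
    P.varCount n t ≤ P.edgeCount n := by
  rw [← hn.card_varSocket]
  have : Fintype.card (P.VarSocket n) = ∑ t, P.varCount n t * (P.var t).len := by
    simp [VarSocket]
  rw [this]
  exact (Nat.le_mul_of_pos_right _ (P.var t).len_pos).trans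
    (Finset.single_le_sum (f := fun t => P.varCount n t * (P.var t).len) (by simp)
      (Finset.mem_univ t))

open Classical in
/-- The fraction of the variable nodes of type `t` that are given the local word `x`. -/
def wordFraction (θ : ℕ × ℕ → ℝ) (s : ℝ) (t : Fin nv) (x : Fin (P.var t).dim → ZMod 2) : ℝ :=
  if P.varWeight t x ∈ P.minPairs t then s * θ (P.varWeight t x) else 0

/-- The fraction of the check nodes of type `t` that are given the local codeword `c`. -/
def codewordFraction (τ : ℝ) (t : Fin nc) (c : (P.chk t).code) : ℝ :=
  if P.chkWeight t c = P.r then τ else 0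

theorem sum_wordFraction_mul (θ : ℕ × ℕ → ℝ) (s : ℝ) (t : Fin nv) (g : ℕ × ℕ → ℝ) :
    ∑ x ∈ Finset.univ.erase (0 : Fin (P.var t).dim → ZMod 2),
        P.wordFraction θ s t x * g (P.varWeight t x)
      = ∑ p ∈ P.minPairs t, (P.var t).iowefCoeff p.1 p.2 * (s * θ p * g p) := by
  classical
  rw [← P.sum_words_minPairs t (fun p => s * θ p * g p)]
  refine Finset.sum_congr rfl fun x _ => ?_
  unfold wordFraction
  split_ifs <;> simp

open Real in
-- All input words with the same minimal weight pair get equal frequency and the zero word takes the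
-- rest. The loss from the zero word is of order `s ^ 2`, negligible against the linear terms.
theorem le_log_varConfig {n w d : ℕ} (hn : P.Realizable n) (θ : ℕ × ℕ → ℝ) (s : ℝ)
    (hsmall : ∀ t, s * ∑ p ∈ P.minPairs t, (P.var t).iowefCoeff p.1 p.2 * θ p ≤ 1 / 2)
    (hint : ∀ t x, ∃ k : ℕ, (k : ℝ) = P.varCount n t * P.wordFraction θ s t x)
    (hw : (w : ℝ) = P.edgeCount n * (s * P.minSum fun p => p.1 * θ p))
    (hd : (d : ℝ) = P.edgeCount n * (s * P.minSum fun p => p.2 * θ p)) :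
    0 < configCount P.varWeight (P.varCount n) (w, d) ∧
      P.edgeCount n * (P.minSum (fun p => s * θ p * (1 - log (s * θ p)))
        - s ^ 2 * ∑ t, (P.lam t : ℝ) / (P.var t).len *
          (2 * (∑ p ∈ P.minPairs t, (P.var t).iowefCoeff p.1 p.2 * θ p) ^ 2))
        - (∑ t, (Fintype.card (Fin (P.var t).dim → ZMod 2) : ℝ)) * (log (P.edgeCount n) + 1)
      ≤ log (configCount P.varWeight (P.varCount n) (w, d)) := by
  classical
  have hsum1 : ∀ t, ∑ x ∈ Finset.univ.erase (0 : Fin (P.var t).dim → ZMod 2),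
      P.wordFraction θ s t x = s * ∑ p ∈ P.minPairs t, (P.var t).iowefCoeff p.1 p.2 * θ p := by
    intro t
    have := P.sum_wordFraction_mul θ s t (fun _ => 1)
    simp only [mul_one] at this
    rw [this, Finset.mul_sum]
    exact Finset.sum_congr rfl fun p _ => by ring
  have hsum2 : ∀ t, ∑ x ∈ Finset.univ.erase (0 : Fin (P.var t).dim → ZMod 2),
      P.wordFraction θ s t x * (1 - log (P.wordFraction θ s t x))
      = ∑ p ∈ P.minPairs t, (P.var t).iowefCoeff p.1 p.2 * (s * θ p * (1 - log (s * θ p))) := by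
    intro t
    rw [← P.sum_wordFraction_mul θ s t fun p => 1 - log (s * θ p)]
    refine Finset.sum_congr rfl fun x _ => ?_
    unfold wordFraction
    split_ifs <;> simp
  have hweight : ∀ g : ℕ × ℕ → ℝ, ∑ t, ∑ x ∈ Finset.univ.erase
      (0 : Fin (P.var t).dim → ZMod 2),
        P.varCount n t * P.wordFraction θ s t x * g (P.varWeight t x)
      = P.edgeCount n * (s * P.minSum fun p => g p * θ p) := by
    intro g
    rw [← minSum_const_mul, minSum, Finset.mul_sum]
    refine Finset.sum_congr rfl fun t _ => ?_
    simp_rw [mul_assoc]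
    rw [← Finset.mul_sum, P.sum_wordFraction_mul θ s t g, hn.edgeCount_cast, hn.varCount_cast,
      mul_assoc]
    congr 2
    exact Finset.sum_congr rfl fun p _ => by ring
  have h := le_log_configCount P.varWeight (P.varCount n) (P.varCount_pos hn) (fun t => 0)
    (fun t => by simp [varWeight]) (P.wordFraction θ s)
    (fun t => by rw [hsum1]; exact hsmall t) hint (P.varCount_le hn) (w, d) ?_
  · refine ⟨h.1, le_trans (le_of_eq ?_) h.2⟩
    congr 1
    rw [minSum, Finset.mul_sum, ← Finset.sum_sub_distrib, Finset.mul_sum]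
    refine Finset.sum_congr rfl fun t _ => ?_
    rw [hsum1, hsum2, hn.edgeCount_cast, hn.varCount_cast]
    ring
  · intro c hc
    have h1 := hweight fun p => p.1
    have h2 := hweight fun p => p.2
    simp_rw [← hc] at h1 h2
    rw [← hw] at h1
    rw [← hd] at h2
    ext
    · simp only [Prod.fst_sum, Prod.smul_fst, smul_eq_mul]
      exact_mod_cast h1
    · simp only [Prod.snd_sum, Prod.smul_snd, smul_eq_mul]
      exact_mod_cast h2

open Real in
theorem le_log_chkConfig {n d : ℕ} (hn : P.Realizable n) (τ : ℝ)
    (hsmall : ∀ t, (P.chk t).wefCoeff P.r * τ ≤ 1 / 2)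
    (hint : ∀ t c, ∃ k : ℕ, (k : ℝ) = P.chkCount n t * P.codewordFraction τ t c)
    (hd : (d : ℝ) = P.edgeCount n * (P.C * τ)) :
    0 < configCount P.chkWeight (P.chkCount n) d ∧
      P.edgeCount n * (P.C / P.r * τ * (1 - log τ)
        - τ ^ 2 * ∑ t, (P.rho t : ℝ) / (P.chk t).len * (2 * (P.chk t).wefCoeff P.r ^ 2))
        - (∑ t, (Fintype.card (P.chk t).code : ℝ)) * (log (P.edgeCount n) + 1)
      ≤ log (configCount P.chkWeight (P.chkCount n) d) := by
  classical
  have hr : (P.r : ℝ) ≠ 0 := by have := P.two_le_r_cast; linarith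
  have hsum1 : ∀ t, ∑ c ∈ Finset.univ.erase (0 : (P.chk t).code), P.codewordFraction τ t c
      = (P.chk t).wefCoeff P.r * τ := fun t => P.sum_codewords_minWeight t τ
  have hsum2 : ∀ t, ∑ c ∈ Finset.univ.erase (0 : (P.chk t).code),
      P.codewordFraction τ t c * (1 - log (P.codewordFraction τ t c))
      = (P.chk t).wefCoeff P.r * (τ * (1 - log τ)) := by
    intro t
    rw [← P.sum_codewords_minWeight]
    refine Finset.sum_congr rfl fun x _ => ?_
    unfold codewordFraction
    split_ifs <;> simp
  have hsum3 : ∀ t, ∑ c ∈ Finset.univ.erase (0 : (P.chk t).code),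
      P.codewordFraction τ t c * P.chkWeight t c = (P.chk t).wefCoeff P.r * (τ * P.r) := by
    intro t
    rw [← P.sum_codewords_minWeight]
    refine Finset.sum_congr rfl fun x _ => ?_
    unfold codewordFraction
    split_ifs with h
    · rw [h]
    · simp
  have h := le_log_configCount P.chkWeight (P.chkCount n) (P.chkCount_pos hn) (fun t => 0)
    (fun t => by simp [chkWeight]) (P.codewordFraction τ)
    (fun t => by rw [hsum1]; exact hsmall t) hint P.chkCount_le d ?_
  · refine ⟨h.1, le_trans (le_of_eq ?_) h.2⟩
    congr 1
    rw [← sum_rho_wefCoeff, mul_assoc, Finset.sum_mul, Finset.mul_sum, ← Finset.sum_sub_distrib,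
      Finset.mul_sum]
    refine Finset.sum_congr rfl fun t _ => ?_
    rw [hsum1, hsum2, hn.edgeCount_cast, hn.chkCount_cast]
    ring
  · intro c hc
    have h1 : (∑ t, ∑ x ∈ Finset.univ.erase (0 : (P.chk t).code),
        (c t x : ℝ) * P.chkWeight t x) = d := by
      rw [hd]
      have : P.C * τ = P.C / P.r * (τ * P.r) := by field_simp
      rw [this, ← sum_rho_wefCoeff, Finset.sum_mul, Finset.mul_sum]
      refine Finset.sum_congr rfl fun t _ => ?_
      simp_rw [hc, mul_assoc]
      rw [← Finset.mul_sum, hsum3, hn.edgeCount_cast, hn.chkCount_cast]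
      ring
    simp only [smul_eq_mul]
    exact_mod_cast h1

open Classical in
-- All node and word numbers are `n` times one of finitely many rationals, so a common denominator
-- `D` makes them integers at every multiple of `D`. This is why `θ`, `s` and `τ` must be rational.
theorem exists_realizable_integral (θ : ℕ × ℕ → ℚ) (hθ : ∀ p, 0 < θ p) {s : ℚ} (hs : 0 < s)
    {τ : ℚ} (hτ : 0 < τ) {a b : ℚ} (ha : 0 < a) (hb : 0 < b) :
    ∃ D : ℕ, 0 < D ∧ ∀ k, 0 < k →
      P.Realizable (k * D) ∧ (∃ w : ℕ, (w : ℝ) = P.edgeCount (k * D) * (a : ℝ)) ∧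
      (∃ d : ℕ, (d : ℝ) = P.edgeCount (k * D) * (b : ℝ)) ∧
      (∀ t x, ∃ m : ℕ, (m : ℝ)
        = P.varCount (k * D) t * P.wordFraction (fun p => (θ p : ℝ)) s t x) ∧
      (∀ t c, ∃ m : ℕ, (m : ℝ) = P.chkCount (k * D) t * P.codewordFraction τ t c) := by
  have hL := P.intLam_pos
  let φ : ∀ t, (Fin (P.var t).dim → ZMod 2) → ℚ := fun t x =>
    if P.varWeight t x ∈ P.minPairs t then s * θ (P.varWeight t x) else 0
  let χ : ∀ t, (P.chk t).code → ℚ := fun t c => if P.chkWeight t c = P.r then τ else 0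
  have hφ : ∀ t x, 0 ≤ φ t x := by
    intro t x
    simp only [φ]
    split_ifs
    · exact (mul_pos hs (hθ _)).le
    · exact le_rfl
  have hχ : ∀ t x, 0 ≤ χ t x := by
    intro t x
    simp only [χ]
    split_ifs
    · exact hτ.le
    · exact le_rfl
  have hl : ∀ t, 0 ≤ P.lam t / (P.var t).len / P.intLam := fun t => by
    have := P.lam_pos t
    positivity
  have hr : ∀ t, 0 ≤ P.rho t / (P.chk t).len / P.intLam := fun t => by
    have := P.rho_pos t
    positivity
  let f : (Fin nv ⊕ Fin nc) ⊕ ((Σ t, (Fin (P.var t).dim → ZMod 2)) ⊕ (Σ t, (P.chk t).code)) ⊕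
      (Unit ⊕ Unit) → ℚ :=
    Sum.elim (Sum.elim (fun t => P.lam t / (P.var t).len / P.intLam)
      (fun t => P.rho t / (P.chk t).len / P.intLam))
    (Sum.elim (Sum.elim (fun x => P.lam x.1 / (P.var x.1).len / P.intLam * φ x.1 x.2)
      (fun x => P.rho x.1 / (P.chk x.1).len / P.intLam * χ x.1 x.2))
    (Sum.elim (fun _ => a / P.intLam) (fun _ => b / P.intLam)))
  obtain ⟨D, hD, hf⟩ := exists_common_denominator f (by
    rintro ((t | t) | (⟨t, x⟩ | ⟨t, x⟩) | (_ | _))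
    · exact hl t
    · exact hr t
    · exact mul_nonneg (hl t) (hφ t x)
    · exact mul_nonneg (hr t) (hχ t x)
    · simp only [f, Sum.elim_inr, Sum.elim_inl]; positivity
    · simp only [f, Sum.elim_inr]; positivity)
  refine ⟨D, hD, fun k hk => ?_⟩
  have hr : P.Realizable (k * D) := by
    refine ⟨Nat.mul_pos hk hD, fun t => ?_, fun t => ?_⟩
    · obtain ⟨m, hm⟩ := hf k (Sum.inl (Sum.inl t))
      have h : ((k * D : ℕ) / P.intLam) * P.lam t / (P.var t).len = (m : ℚ) := by
        rw [← hm]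
        simp only [f, Sum.elim_inl]
        ring
      rw [varCount, h, Nat.floor_natCast]
    · obtain ⟨m, hm⟩ := hf k (Sum.inl (Sum.inr t))
      have h : ((k * D : ℕ) / P.intLam) * P.rho t / (P.chk t).len = (m : ℚ) := by
        rw [← hm]
        simp only [f, Sum.elim_inl, Sum.elim_inr]
        ring
      rw [chkCount, h, Nat.floor_natCast]
  refine ⟨hr, ?_, ?_, fun t x => ?_, fun t c => ?_⟩
  · obtain ⟨m, hm⟩ := hf k (Sum.inr (Sum.inr (Sum.inl ())))
    refine ⟨m, ?_⟩
    have hm' := congrArg (Rat.cast (K := ℝ)) hm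
    simp only [f, Sum.elim_inl, Sum.elim_inr] at hm'
    push_cast at hm'
    rw [hr.edgeCount_cast, ← hm']
    push_cast
    ring
  · obtain ⟨m, hm⟩ := hf k (Sum.inr (Sum.inr (Sum.inr ())))
    refine ⟨m, ?_⟩
    have hm' := congrArg (Rat.cast (K := ℝ)) hm
    simp only [f, Sum.elim_inr] at hm'
    push_cast at hm'
    rw [hr.edgeCount_cast, ← hm']
    push_cast
    ring
  · obtain ⟨m, hm⟩ := hf k (Sum.inr (Sum.inl (Sum.inl ⟨t, x⟩)))
    refine ⟨m, ?_⟩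
    have hφ' : (φ t x : ℝ) = P.wordFraction (fun p => (θ p : ℝ)) s t x := by
      simp only [φ, wordFraction]
      split_ifs <;> simp
    have hm' := congrArg (Rat.cast (K := ℝ)) hm
    simp only [f, Sum.elim_inl, Sum.elim_inr] at hm'
    push_cast at hm'
    rw [hr.varCount_cast, ← hm', ← hφ']
    push_cast
    ring
  · obtain ⟨m, hm⟩ := hf k (Sum.inr (Sum.inl (Sum.inr ⟨t, c⟩)))
    refine ⟨m, ?_⟩
    have hχ' : (χ t c : ℝ) = P.codewordFraction τ t c := by
      simp only [χ, codewordFraction]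
      split_ifs <;> simp
    have hm' := congrArg (Rat.cast (K := ℝ)) hm
    simp only [f, Sum.elim_inl, Sum.elim_inr] at hm'
    push_cast at hm'
    rw [hr.chkCount_cast, ← hm', ← hχ']
    push_cast
    ring

open Real in
-- The frequency of minimum-weight check codewords is chosen as `s * q₁ / C`, so that the check
-- nodes see as many ones as the variable nodes emit. The constant `K₁` is independent of `s`, which
-- makes the quadratic loss negligible as `s → 0`.
theorem exists_le_log_expTerm (θ : ℕ × ℕ → ℚ) (hθ : ∀ p, 0 < θ p) :
    ∃ s₁ : ℝ, 0 < s₁ ∧ ∃ K₁ : ℝ, ∀ s : ℚ, 0 < s → (s : ℝ) < s₁ → ∃ D : ℕ, 0 < D ∧ ∃ K₂ : ℝ,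
      ∀ k, 0 < k → ∃ w d : ℕ, P.Realizable (k * D) ∧
        (w : ℝ) = s * (P.minSum fun p => p.1 * θ p) / P.intLam * (k * D : ℕ) ∧
        0 < P.expTerm (k * D) w d ∧
        P.edgeCount (k * D) * (P.lowerRate (fun p => θ p) s - K₁ * s ^ 2)
          - K₂ * (log (P.edgeCount (k * D)) + 1) ≤ log (P.expTerm (k * D) w d) := by
  have hC := P.C_pos
  have hL := P.intLam_pos'
  have hθ' : ∀ p, (0 : ℝ) < θ p := fun p => by exact_mod_cast hθ p
  set q₁ := P.minSum fun p => p.2 * (θ p : ℝ) with hq₁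
  set q₂ := P.minSum fun p => p.1 * (θ p : ℝ) with hq₂
  have hq₁pos : 0 < q₁ := minSum_pos fun t p hp => by
    have : (0 : ℝ) < p.2 := by exact_mod_cast two_pos.trans_le (pos_of_mem_minPairs hp).2
    exact mul_pos this (hθ' p)
  have hq₂pos : 0 < q₂ := minSum_pos fun t p hp => by
    have : (0 : ℝ) < p.1 := by exact_mod_cast (pos_of_mem_minPairs hp).1
    exact mul_pos this (hθ' p)
  obtain ⟨q₁', hq₁'⟩ := P.exists_rat_minSum fun p => p.2 * θ p
  obtain ⟨q₂', hq₂'⟩ := P.exists_rat_minSum fun p => p.1 * θ p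
  obtain ⟨C', hC'⟩ := P.exists_rat_C
  push_cast at hq₁' hq₂'
  rw [← hq₁] at hq₁'
  rw [← hq₂] at hq₂'
  have hq₁'pos : 0 < q₁' := by
    have : (0 : ℝ) < q₁' := hq₁' ▸ hq₁pos
    exact_mod_cast this
  have hq₂'pos : 0 < q₂' := by
    have : (0 : ℝ) < q₂' := hq₂' ▸ hq₂pos
    exact_mod_cast this
  have hC'pos : 0 < C' := by
    have : (0 : ℝ) < C' := hC' ▸ hC
    exact_mod_cast this
  let A : Fin nv → ℝ := fun t => ∑ p ∈ P.minPairs t, (P.var t).iowefCoeff p.1 p.2 * (θ p : ℝ)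
  have hA : ∀ t, 0 ≤ A t := fun t => Finset.sum_nonneg fun p _ =>
    mul_nonneg (Nat.cast_nonneg _) (hθ' p).le
  let W : Fin nc → ℝ := fun t => (P.chk t).wefCoeff P.r
  have hW : ∀ t, 0 ≤ W t := fun t => Nat.cast_nonneg _
  have hAle : ∀ t, A t ≤ ∑ t, A t := fun t =>
    Finset.single_le_sum (fun t _ => hA t) (Finset.mem_univ t)
  have hWle : ∀ t, W t ≤ ∑ t, W t := fun t =>
    Finset.single_le_sum (fun t _ => hW t) (Finset.mem_univ t)
  have hAs : 0 ≤ ∑ t, A t := Finset.sum_nonneg fun t _ => hA t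
  have hWs : 0 ≤ ∑ t, W t := Finset.sum_nonneg fun t _ => hW t
  -- The bound `s * M < 1/2` controls at once the nonzero local words of each variable type, those
  -- of each check type, and `d / E`.
  set M := ∑ t, A t + q₁ / P.C * ∑ t, W t + q₁ with hM
  have hWs' : 0 ≤ q₁ / P.C * ∑ t, W t := by positivity
  have hMpos : 0 < M := by linarith
  refine ⟨1 / (2 * M), by positivity, ?_⟩
  refine ⟨∑ t, (P.lam t : ℝ) / (P.var t).len * (2 * A t ^ 2) +
    (q₁ / P.C) ^ 2 * ∑ t, (P.rho t : ℝ) / (P.chk t).len * (2 * W t ^ 2), ?_⟩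
  intro s hs hs1
  have hs' : (0 : ℝ) < s := by exact_mod_cast hs
  have hsM : s * M < 1 / 2 := by
    rw [lt_div_iff₀ (by positivity)] at hs1
    linarith
  have hsA : ∀ t, s * A t ≤ 1 / 2 := fun t => by
    have := mul_le_mul_of_nonneg_left (show A t ≤ M by linarith [hAle t]) hs'.le
    linarith
  have hsW : ∀ t, W t * (s * q₁ / P.C) ≤ 1 / 2 := fun t => by
    have h1 := mul_le_mul_of_nonneg_left (hWle t) (by positivity : 0 ≤ q₁ / P.C)
    have := mul_le_mul_of_nonneg_left (show q₁ / P.C * W t ≤ M by linarith) hs'.le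
    have h2 : W t * (s * q₁ / P.C) = s * (q₁ / P.C * W t) := by ring
    linarith
  have hsq : s * q₁ ≤ 1 / 2 := by
    have := mul_le_mul_of_nonneg_left (show q₁ ≤ M by linarith) hs'.le
    linarith
  obtain ⟨D, hD, hk⟩ := P.exists_realizable_integral θ hθ hs (τ := s * q₁' / C') (by positivity)
    (a := s * q₂') (b := s * q₁') (by positivity) (by positivity)
  refine ⟨D, hD, (∑ t, (Fintype.card (Fin (P.var t).dim → ZMod 2) : ℝ))
    + ∑ t, (Fintype.card (P.chk t).code : ℝ), fun k hk0 => ?_⟩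
  obtain ⟨hn, ⟨w, hw⟩, ⟨d, hd⟩, hint1, hint2⟩ := hk k hk0
  push_cast at hw hd hint2
  rw [hq₁'] at hd hint2
  rw [hq₂'] at hw
  rw [hC'] at hint2
  obtain ⟨hv0, hv⟩ := P.le_log_varConfig hn (fun p => θ p) s hsA hint1 hw hd
  obtain ⟨hc0, hc⟩ := P.le_log_chkConfig (d := d) hn (s * q₁ / P.C) hsW hint2
    (by rw [hd]; field_simp)
  have hn0 : (0 : ℝ) < (k * D : ℕ) := by exact_mod_cast hn.1
  have hE0 : (0 : ℝ) < P.edgeCount (k * D) := by rw [hn.edgeCount_cast]; positivity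
  have hdE : d ≤ P.edgeCount (k * D) := by
    have : (d : ℝ) ≤ P.edgeCount (k * D) := by rw [hd]; nlinarith
    exact_mod_cast this
  have hd0 : 0 < d := by
    have : (0 : ℝ) < d := by rw [hd]; positivity
    exact_mod_cast this
  have hch := log_choose_le_linear hdE hd0 hd
  refine ⟨w, d, hn, ?_, expTerm_pos_iff.2 ⟨hv0, hc0, hdE⟩, ?_⟩
  · rw [hw, hn.edgeCount_cast]
    ring
  · have hexp : log (P.expTerm (k * D) w d)
        = log (configCount P.varWeight (P.varCount (k * D)) (w, d)) +
          log (configCount P.chkWeight (P.chkCount (k * D)) d)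
          - log ((P.edgeCount (k * D)).choose d) := by
      have := Nat.choose_pos hdE
      unfold expTerm
      rw [log_div (by positivity) (by positivity), log_mul (by positivity) (by positivity)]
    rw [hexp]
    have hCr : P.C / P.r * (s * q₁ / P.C) = s * q₁ / P.r := by field_simp
    rw [hCr] at hc
    unfold lowerRate
    rw [← hq₁]
    have hsq : (s * q₁ / P.C) ^ 2 = s ^ 2 * (q₁ / P.C) ^ 2 := by ring
    rw [hsq] at hc
    simp only [A, W]
    linarith

/-! ### Choice of the proportions of local words -/

/-- The expansion of the weight spectral shape at zero. -/
def expansion (α : ℝ) : ℝ :=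
  P.T / P.psi * (α * Real.log α) + α * (Real.log (1 / P.Q1inv 1) +
    P.T / P.psi * Real.log (1 / P.Q2 (P.Q1inv 1)))

/-- The loss in the lower bound when the proportions `θ` are not the optimal ones. -/
def lowerGap (θ : ℕ × ℕ → ℝ) : ℝ :=
  P.minSum (fun p => θ p * (Real.log (P.minTerm (P.Q1inv 1) p) - Real.log (θ p)))
    + P.minSum θ * Real.log (P.minSum fun p => p.2 * θ p)
    + P.minSum (fun p => p.1 * θ p) * (P.T / P.psi) *
      (Real.log (P.minSum fun p => p.2 * θ p) - Real.log (P.minSum fun p => p.1 * θ p)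
        + Real.log (P.Q2 (P.Q1inv 1)))

open Real in
-- The total coefficient of `s log s` is `q₁ (1 - 1/r) - minSum θ`, which equals `(T/ψ) q₂` because
-- `j = ψ + i T` on minimal pairs. This accounts for the `α log α` term.
theorem lowerRate_eq {θ : ℕ × ℕ → ℝ} (hθ : ∀ p, 0 < θ p) {s : ℝ} (hs : 0 < s) :
    P.lowerRate θ s = s * P.lowerGap θ
      + P.intLam * P.expansion (s * (P.minSum fun p => p.1 * θ p) / P.intLam) := by
  have hC := P.C_pos
  have hL := P.intLam_pos'
  have hψ := P.psi_pos
  have hr := P.two_le_r_cast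
  have hx0 := P.Q1inv_pos
  have hQ2 := P.Q2_pos
  have hpsi := minSum_eq_psi_add (P := P) θ
  have hinv := P.inv_psi
  have hγ : P.minSum (fun p => θ p * log (P.minTerm (P.Q1inv 1) p))
      = log P.C / P.r * (P.minSum fun p => p.2 * θ p)
        + (P.T / P.psi * (log P.intLam - 1) + log (P.Q1inv 1)) *
          P.minSum fun p => p.1 * θ p := by
    rw [← minSum_const_mul, ← minSum_const_mul, ← minSum_add]
    refine minSum_congr fun t p _ => ?_
    rw [minTerm, log_mul (by positivity) (by positivity), log_mul (by positivity) (by positivity),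
      log_rpow hC, log_rpow (by positivity), log_pow, log_div hL.ne' (exp_pos 1).ne', log_exp]
    ring
  have hgap : P.minSum (fun p => θ p * (log (P.minTerm (P.Q1inv 1) p) - log (θ p)))
      = P.minSum (fun p => θ p * log (P.minTerm (P.Q1inv 1) p))
        + -1 * P.minSum fun p => θ p * log (θ p) := by
    rw [← minSum_const_mul, ← minSum_add]
    exact minSum_congr fun t p _ => by ring
  have hent : P.minSum (fun p => s * θ p * (1 - log (s * θ p)))
      = s * (1 - log s) * P.minSum θ + -s * P.minSum fun p => θ p * log (θ p) := by
    rw [← minSum_const_mul, ← minSum_const_mul, ← minSum_add]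
    refine minSum_congr fun t p _ => ?_
    rw [log_mul hs.ne' (hθ p).ne']
    ring
  have hq₁pos : 0 < P.minSum fun p => p.2 * θ p := minSum_pos fun t p hp => by
    have : (0 : ℝ) < p.2 := by exact_mod_cast two_pos.trans_le (pos_of_mem_minPairs hp).2
    exact mul_pos this (hθ p)
  have hq₂pos : 0 < P.minSum fun p => p.1 * θ p := minSum_pos fun t p hp => by
    have : (0 : ℝ) < p.1 := by exact_mod_cast (pos_of_mem_minPairs hp).1
    exact mul_pos this (hθ p)
  unfold lowerRate lowerGap expansion
  rw [hgap, hγ, hent]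
  set q₁ := P.minSum fun p => p.2 * θ p
  set q₂ := P.minSum fun p => p.1 * θ p
  have hΘ : P.minSum θ = q₁ * (1 - 1 / P.r) - P.T / P.psi * q₂ := by
    rw [← hinv, hpsi]
    field_simp
    ring
  rw [hΘ, log_div (by positivity) hC.ne', log_mul hs.ne' hq₁pos.ne',
    log_div (by positivity) hL.ne', log_mul hs.ne' hq₂pos.ne']
  simp only [one_div, log_inv]
  field_simp
  ring

theorem tendsto_minSum {g : ℕ → ℕ × ℕ → ℝ} {h : ℕ × ℕ → ℝ}
    (H : ∀ t, ∀ p ∈ P.minPairs t, Tendsto (fun k => g k p) atTop (𝓝 (h p))) :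
    Tendsto (fun k => P.minSum (g k)) atTop (𝓝 (P.minSum h)) := by
  unfold minSum
  exact tendsto_finsetSum _ fun t _ => (tendsto_finsetSum _ fun p hp =>
    (H t p hp).const_mul _).const_mul _

/-- At `θ = minTerm x₀` the weighted sums are `Q₁(x₀) = 1` and `Q₂(x₀)`, so every part of the gap
vanishes. The gap is continuous there, and rational approximations suffice. -/
theorem exists_lowerGap_ge {ε : ℝ} (hε : 0 < ε) : ∃ θ : ℕ × ℕ → ℚ, (∀ p, 0 < θ p) ∧
    -(ε * P.minSum fun p => p.1 * (θ p : ℝ)) < P.lowerGap fun p => θ p := by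
  set γ := P.minTerm (P.Q1inv 1) with hγ
  have hγpos : ∀ p, 0 < γ p := P.minTerm_pos P.Q1inv_pos
  have hQ2 := P.Q2_pos
  have hex : ∀ (k : ℕ) p, ∃ q : ℚ, γ p < q ∧ (q : ℝ) < γ p + 1 / ((k : ℝ) + 1) := fun k p =>
    exists_rat_btwn (by have : 0 < 1 / ((k : ℝ) + 1) := by positivity
                        linarith)
  choose θ hθ1 hθ2 using hex
  have hlim : ∀ p, Tendsto (fun k => (θ k p : ℝ)) atTop (𝓝 (γ p)) := by
    intro p
    refine tendsto_of_tendsto_of_tendsto_of_le_of_le tendsto_const_nhds ?_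
      (fun k => (hθ1 k p).le) (fun k => (hθ2 k p).le)
    simpa using tendsto_one_div_add_atTop_nhds_zero_nat.const_add (γ p)
  have h1 : Tendsto (fun k => P.minSum fun p => p.2 * (θ k p : ℝ)) atTop (𝓝 1) := by
    have := P.tendsto_minSum (g := fun k p => p.2 * (θ k p : ℝ)) fun t p _ =>
      (hlim p).const_mul (p.2 : ℝ)
    rwa [← P.Q1_eq, P.Q1_Q1inv] at this
  have h2 : Tendsto (fun k => P.minSum fun p => p.1 * (θ k p : ℝ)) atTop
      (𝓝 (P.Q2 (P.Q1inv 1))) := by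
    have := P.tendsto_minSum (g := fun k p => p.1 * (θ k p : ℝ)) fun t p _ =>
      (hlim p).const_mul (p.1 : ℝ)
    rwa [← P.Q2_eq] at this
  have h3 : Tendsto (fun k => P.minSum fun p => (θ k p : ℝ)) atTop (𝓝 (P.minSum γ)) :=
    P.tendsto_minSum fun t p _ => hlim p
  have h4 : Tendsto (fun k => P.minSum fun p => (θ k p : ℝ) *
      (Real.log (γ p) - Real.log (θ k p))) atTop
      (𝓝 (P.minSum fun p => γ p * (Real.log (γ p) - Real.log (γ p)))) :=
    P.tendsto_minSum fun t p _ => (hlim p).mul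
      (tendsto_const_nhds.sub ((hlim p).log (hγpos p).ne'))
  have h5 : Tendsto (fun k => P.lowerGap (fun p => θ k p)
      + ε * P.minSum fun p => p.1 * (θ k p : ℝ)) atTop (𝓝 (ε * P.Q2 (P.Q1inv 1))) := by
    have := ((h4.add (h3.mul (h1.log one_ne_zero))).add ((h2.mul_const (P.T / P.psi)).mul
      (((h1.log one_ne_zero).sub (h2.log hQ2.ne')).add_const (Real.log (P.Q2 (P.Q1inv 1)))))).add
      (h2.const_mul ε)
    have h0 : (P.minSum fun _ => (0 : ℝ)) = 0 := by simp [minSum]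
    simpa [h0, lowerGap] using this
  obtain ⟨k, hk⟩ := (h5.eventually_const_lt (mul_pos hε hQ2)).exists
  refine ⟨θ k, fun p => ?_, by linarith⟩
  have := (hγpos p).trans (hθ1 k p)
  exact_mod_cast this

/-! ### Conclusion -/

theorem mem_spectralDomain_of_frequently {α : ℝ} (hα : 0 < α) {D : ℕ} (hD : 0 < D)
    (h : ∀ k, 0 < k → P.Admissible α (k * D)) : α ∈ P.spectralDomain := by
  refine ⟨hα, Filter.frequently_atTop.2 fun N => ⟨(N + 1) * D, ?_, h _ N.succ_pos⟩⟩
  nlinarith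

theorem exists_rat_mem_spectralDomain :
    ∃ α₁ : ℝ, 0 < α₁ ∧ ∀ α : ℚ, 0 < (α : ℝ) → (α : ℝ) < α₁ → (α : ℝ) ∈ P.spectralDomain := by
  have hL := P.intLam_pos
  -- Only positivity of a summand matters here, so any positive proportions will do.
  obtain ⟨s₁, hs₁, K₁, hs⟩ := P.exists_le_log_expTerm (fun _ => 1) fun _ => one_pos
  obtain ⟨q, hq⟩ := P.exists_rat_minSum fun p => p.1 * 1
  push_cast at hq hs
  rw [← hq] at hs
  have hq0 : (0 : ℝ) < q := by
    rw [hq]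
    refine minSum_pos fun t p hp => ?_
    have : (0 : ℝ) < p.1 := by exact_mod_cast (pos_of_mem_minPairs hp).1
    simpa using this
  have hq0' : 0 < q := by exact_mod_cast hq0
  have hL' := P.intLam_pos'
  refine ⟨s₁ * q / P.intLam, by positivity, fun α hα hα1 => ?_⟩
  have hα' : 0 < α := by exact_mod_cast hα
  obtain ⟨D, hD, K₂, hk⟩ := hs (α * P.intLam / q) (by positivity) (by
    push_cast
    rw [lt_div_iff₀ hL'] at hα1
    rw [div_lt_iff₀ hq0]
    exact hα1)
  refine P.mem_spectralDomain_of_frequently hα hD fun k hk0 => ?_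
  obtain ⟨w, d, hn, hw, ht, -⟩ := hk k hk0
  refine admissible_of_expTerm_pos hn (w := w) (d := d) ?_ ht
  rw [hw]
  push_cast
  field_simp

theorem exists_rat_of_mem_spectralDomain {α : ℝ} (h : α ∈ P.spectralDomain) :
    ∃ q : ℚ, (q : ℝ) = α := by
  obtain ⟨n, hn⟩ := h.2.exists
  obtain ⟨w, hw⟩ := hn.2.1
  have hn0 : (n : ℝ) ≠ 0 := by exact_mod_cast hn.1.1.ne'
  refine ⟨w / n, ?_⟩
  push_cast
  rw [hw]
  field_simp

theorem weightRatio_mul_lt {α : ℝ} {c : ℝ} (hα1 : α < c / (P.weightRatio * P.intLam)) :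
    P.weightRatio * α * P.intLam < c := by
  have hL := P.intLam_pos'
  have hκ : (0 : ℝ) < P.weightRatio := by exact_mod_cast P.weightRatio_pos
  rw [lt_div_iff₀ (by positivity)] at hα1
  linarith

open Real in
theorem spectralShape_ge {ε : ℝ} (hε : 0 < ε) : ∃ α₁ : ℝ, 0 < α₁ ∧ ∀ α ∈ P.spectralDomain,
    α < α₁ → P.expansion α - ε * α ≤ P.spectralShape α := by
  have hL := P.intLam_pos'
  have hLq := P.intLam_pos
  have hκ : (0 : ℝ) < P.weightRatio := by exact_mod_cast P.weightRatio_pos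
  obtain ⟨θ, hθ, hgap⟩ := P.exists_lowerGap_ge (half_pos hε)
  obtain ⟨s₁, hs₁, K₁, hs⟩ := P.exists_le_log_expTerm θ hθ
  obtain ⟨q, hq⟩ := P.exists_rat_minSum fun p => p.1 * θ p
  push_cast at hq
  have hθ' : ∀ p, (0 : ℝ) < θ p := fun p => by exact_mod_cast hθ p
  have hq0 : (0 : ℝ) < q := by
    rw [hq]
    refine minSum_pos fun t p hp => ?_
    have : (0 : ℝ) < p.1 := by exact_mod_cast (pos_of_mem_minPairs hp).1
    exact mul_pos this (hθ' p)
  have hq0' : 0 < q := by exact_mod_cast hq0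
  rw [← hq] at hs hgap
  -- Half of `ε` pays for the gap of `θ`, the other half for the quadratic loss.
  obtain ⟨s₂, hs₂, hK⟩ : ∃ s₂ : ℝ, 0 < s₂ ∧ ∀ s, 0 < s → s < s₂ → K₁ * s ≤ ε / 2 * q := by
    refine ⟨ε / 2 * q / (|K₁| + 1), by positivity, fun s h0 h1 => ?_⟩
    rw [lt_div_iff₀ (by positivity)] at h1
    nlinarith [le_abs_self K₁]
  refine ⟨min (min (s₁ * q / P.intLam) (s₂ * q / P.intLam)) (1 / (P.weightRatio * P.intLam)),
    by positivity, fun α hαd hα1 => ?_⟩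
  obtain ⟨hα0, hfreq⟩ := hαd
  rw [lt_min_iff, lt_min_iff] at hα1
  obtain ⟨⟨hα1, hα2⟩, hα3⟩ := hα1
  obtain ⟨-, hspec⟩ := spectralShape_spec hα0 (P.weightRatio_mul_lt hα3) hfreq
  obtain ⟨α', rfl⟩ := P.exists_rat_of_mem_spectralDomain ⟨hα0, hfreq⟩
  have hα' : 0 < α' := by exact_mod_cast hα0
  -- This scale gives relative weight exactly `α'`; it is rational because elements of the domain
  -- are ratios `w / n`.
  set s : ℚ := α' * P.intLam / q with hs_def
  have hsq : (s : ℝ) = α' * P.intLam / q := by rw [hs_def]; push_cast; rfl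
  have hs0 : 0 < s := by positivity
  have hs0' : (0 : ℝ) < s := by exact_mod_cast hs0
  have hslt1 : (s : ℝ) < s₁ := by
    rw [lt_div_iff₀ hL] at hα1
    rw [hsq, div_lt_iff₀ hq0]
    exact hα1
  have hslt2 : (s : ℝ) < s₂ := by
    rw [lt_div_iff₀ hL] at hα2
    rw [hsq, div_lt_iff₀ hq0]
    exact hα2
  have hαs : (s : ℝ) * q / P.intLam = α' := by rw [hsq]; field_simp
  obtain ⟨D, hD, K₂, hk⟩ := hs s hs0 hslt1
  rw [hαs] at hk
  rw [P.lowerRate_eq hθ' hs0', ← hq, hαs] at hk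
  obtain ⟨B, hB0, hB⟩ := P.exists_log_edgeCount_le
  have hcore : P.expansion α' - ε * α' ≤
      (s * P.lowerGap (fun p => θ p) + P.intLam * P.expansion α' - K₁ * s ^ 2) / P.intLam := by
    rw [le_div_iff₀ hL]
    have h1 := hK s hs0' hslt2
    have h2 : (α' : ℝ) * P.intLam = s * q := by rw [← hαs]; field_simp
    have h3 : 0 ≤ s * (P.lowerGap (fun p => θ p) + ε * q - K₁ * s) :=
      mul_nonneg hs0'.le (by linarith)
    have h4 : (P.expansion α' - ε * α') * P.intLam = P.intLam * P.expansion α' - ε * (s * q) := by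
      rw [← h2]; ring
    rw [h4]
    linarith
  refine hcore.trans ?_
  set R := s * P.lowerGap (fun p => θ p) + P.intLam * P.expansion α' - K₁ * s ^ 2
  -- Each length `(k + 1) * D` gives a rate that bounds the spectral shape from below; letting `k →
  -- ∞` removes the logarithmic errors.
  have hlim : Tendsto (fun k : ℕ => R / P.intLam -
      ((|K₂| + 2) * log (((k + 1) * D : ℕ)) + ((|K₂| + 2) * (B + 1))) / ((k + 1) * D : ℕ)) atTop
      (𝓝 (R / P.intLam - 0)) := by
    have h1 : Tendsto (fun k : ℕ => (k + 1) * D) atTop atTop :=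
      (tendsto_add_atTop_nat 1).atTop_mul_const' hD
    exact tendsto_const_nhds.sub
      ((tendsto_log_add_div (|K₂| + 2) ((|K₂| + 2) * (B + 1))).comp h1)
  rw [sub_zero] at hlim
  refine le_of_tendsto hlim (Eventually.of_forall fun k => ?_)
  obtain ⟨w, d, hn, hw, ht, hlog⟩ := hk (k + 1) k.succ_pos
  refine le_trans ?_ (hspec _ w d hn hw ht)
  have hn0 : (0 : ℝ) < ((k + 1) * D : ℕ) := by exact_mod_cast hn.1
  have hlogE := (hB _ hn).1
  have hlogE0 := log_natCast_nonneg (P.edgeCount ((k + 1) * D))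
  rw [termRate, le_div_iff₀ hn0, sub_mul, div_mul_cancel₀ _ hn0.ne']
  rw [hn.edgeCount_cast] at hlog
  have hRE : (((k + 1) * D : ℕ) : ℝ) / P.intLam * R = R / P.intLam * ((k + 1) * D : ℕ) := by ring
  rw [hRE, ← hn.edgeCount_cast] at hlog
  have h3 : K₂ * (log (P.edgeCount ((k + 1) * D)) + 1)
      ≤ |K₂| * (log ((k + 1) * D : ℕ) + B + 1) :=
    (mul_le_mul_of_nonneg_right (le_abs_self K₂) (by linarith)).trans
      (mul_le_mul_of_nonneg_left (by linarith) (abs_nonneg K₂))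
  nlinarith

open Real in
theorem spectralShape_le {ε : ℝ} (hε : 0 < ε) : ∃ α₁ : ℝ, 0 < α₁ ∧ ∀ α ∈ P.spectralDomain,
    α < α₁ → P.spectralShape α ≤ P.expansion α + ε * α := by
  have hL := P.intLam_pos'
  have hC := P.C_pos
  have hx0 := P.Q1inv_pos
  have hQ2 := P.Q2_pos
  have hκ : (0 : ℝ) < P.weightRatio := by exact_mod_cast P.weightRatio_pos
  obtain ⟨δ₁, hδ₁, herr⟩ : ∃ δ₁ : ℝ, 0 < δ₁ ∧ ∀ δ, 0 < δ → δ < δ₁ →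
      P.upperErr δ ≤ ε / P.weightRatio * δ := by
    have h1 := (isLittleO_iff.1 P.upperErr_isLittleO) (div_pos hε hκ)
    obtain ⟨δ₁, hδ₁, h2⟩ := mem_nhdsGT_iff_exists_Ioo_subset.1 h1
    refine ⟨δ₁, hδ₁, fun δ h3 h4 => ?_⟩
    have h5 : ‖P.upperErr δ‖ ≤ ε / P.weightRatio * ‖δ‖ := h2 ⟨h3, h4⟩
    rw [norm_eq_abs, norm_eq_abs, abs_of_pos h3] at h5
    exact (le_abs_self _).trans h5
  -- Since `δ ≤ weightRatio * α * ∫λ`, this keeps `δ` below `δ₁` for the error, below `C` so that `z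
  -- ≤ 1`, and below `1`. The constant `ε / weightRatio` in front of `δ` was chosen to give `ε * α`
  -- in the end.
  refine ⟨min (min δ₁ P.C) 1 / (P.weightRatio * P.intLam), by positivity, fun α hαd hα1 => ?_⟩
  obtain ⟨hα0, hfreq⟩ := hαd
  have hα2 := P.weightRatio_mul_lt hα1
  rw [lt_min_iff, lt_min_iff] at hα2
  obtain ⟨⟨hα2, hα3⟩, hα4⟩ := hα2
  obtain ⟨htend, -⟩ := spectralShape_spec hα0 hα4 hfreq
  have hne : (P.admissibleFilter α).NeBot := by
    rw [admissibleFilter, ← frequently_mem_iff_neBot]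
    exact hfreq
  obtain ⟨B, hB0, hB⟩ := P.exists_log_edgeCount_le
  have hlim : Tendsto (fun n : ℕ => P.expansion α + ε * α + (3 * log n + (3 * B + 2)) / n)
      (P.admissibleFilter α) (𝓝 (P.expansion α + ε * α + 0)) :=
    (tendsto_const_nhds.add (tendsto_log_add_div 3 (3 * B + 2))).mono_left inf_le_left
  rw [add_zero] at hlim
  refine le_of_tendsto_of_tendsto htend hlim ?_
  unfold EventuallyLE
  rw [admissibleFilter, eventually_inf_principal]
  refine Eventually.of_forall fun n hn => ?_
  have hn0 : (0 : ℝ) < n := by exact_mod_cast hn.1.1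
  obtain ⟨w, d, hw, ht, hle⟩ := hn.exists_expTerm
  obtain ⟨hd0, hdE⟩ := edgeWeight_mem_Ioo hα0 hα4 hn.1 hw ht
  have hpos := hn.2.2
  rw [floor_eq_of_cast_eq hw] at hpos
  have hlog := log_le_log hpos hle
  rw [log_mul (by positivity) ht.ne'] at hlog
  have hEn := hn.1.edgeCount_cast
  have hE0 : (0 : ℝ) < P.edgeCount n := by rw [hEn]; positivity
  have hd0' : (0 : ℝ) < d := by exact_mod_cast hd0
  set δ : ℝ := d / P.edgeCount n with hδ
  have hδ0 : 0 < δ := by positivity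
  have hδle : δ ≤ P.weightRatio * α * P.intLam := by
    have h1 : (d : ℝ) ≤ P.weightRatio * w := by
      exact_mod_cast (weight_le_of_configCount_pos (expTerm_pos_iff.1 ht).1).1
    rw [hδ, div_le_iff₀ hE0, hEn]
    rw [hw] at h1
    refine h1.trans (le_of_eq ?_)
    field_simp
  have hmain := P.log_expTerm_le hn.1 ht (a := α * P.intLam) (δ := δ)
    (by rw [hw, hEn]; field_simp) (by rw [hδ]; field_simp) (by positivity) hδ0
    (by linarith) (by linarith)
  have herr' := herr δ hδ0 (by linarith)
  have herr'' : ε / P.weightRatio * δ ≤ ε * α * P.intLam := by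
    refine (mul_le_mul_of_nonneg_left hδle (by positivity)).trans (le_of_eq ?_)
    field_simp
  have hexp : P.T / P.psi * (α * P.intLam *
      log (α * P.intLam / (P.intLam * P.Q2 (P.Q1inv 1)))) - α * P.intLam * log (P.Q1inv 1)
      = P.intLam * P.expansion α := by
    rw [mul_comm α, mul_div_mul_left _ _ hL.ne', log_div hα0.ne' hQ2.ne', expansion, one_div,
      log_inv, one_div, log_inv]
    ring
  rw [hexp] at hmain
  obtain ⟨hB1, hB2⟩ := hB n hn.1
  rw [normLogExp, floor_eq_of_cast_eq hw, one_div, inv_mul_eq_div, div_le_iff₀ hn0, add_mul,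
    div_mul_cancel₀ _ hn0.ne']
  have h6 : P.edgeCount n * (P.intLam * P.expansion α + P.upperErr δ)
      ≤ (P.expansion α + ε * α) * n := by
    have h7 := mul_le_mul_of_nonneg_left (herr'.trans herr'') hE0.le
    have h8 : P.edgeCount n * (P.intLam * P.expansion α + ε * α * P.intLam)
        = (P.expansion α + ε * α) * n := by
      rw [hEn]; field_simp
    linarith
  linarith

end Params
end DGLDPC

end

theorem corollary1 {nc nv : ℕ} (P : DGLDPC.Params nc nv) :
    (∃ α₀ : ℝ, 0 < α₀ ∧ ∀ α : ℚ, 0 < (α : ℝ) → (α : ℝ) < α₀ →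
      (α : ℝ) ∈ P.spectralDomain ∧
      Tendsto (P.normLogExp α) (P.admissibleFilter α) (𝓝 (P.spectralShape α))) ∧
    0 < P.C ∧
    Set.BijOn P.Q1 (Set.Ici 0) (Set.Ici 0) ∧
    (fun α : ℝ => P.spectralShape α -
      (P.T / P.psi * (α * Real.log α) +
        α * (Real.log (1 / P.Q1inv 1) +
          P.T / P.psi * Real.log (1 / P.Q2 (P.Q1inv 1)))))
      =o[𝓝[P.spectralDomain] 0] (fun α : ℝ => α) := by
  refine ⟨?_, P.C_pos, P.bijOn_Q1, ?_⟩
  · obtain ⟨α₁, hα₁, h⟩ := P.exists_rat_mem_spectralDomain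
    have hL := P.intLam_pos'
    have hκ : (0 : ℝ) < P.weightRatio := by exact_mod_cast P.weightRatio_pos
    refine ⟨min α₁ (1 / (P.weightRatio * P.intLam)), by positivity, fun α hα hα1 => ?_⟩
    have hdom := h α hα (hα1.trans_le (min_le_left _ _))
    exact ⟨hdom, (DGLDPC.Params.spectralShape_spec hα
      (P.weightRatio_mul_lt (hα1.trans_le (min_le_right _ _))) hdom.2).1⟩
  · rw [isLittleO_iff]
    intro ε hε
    obtain ⟨α₁, hα₁, h1⟩ := P.spectralShape_le hε
    obtain ⟨α₂, hα₂, h2⟩ := P.spectralShape_ge hε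
    have hlt : ∀ᶠ α : ℝ in 𝓝[P.spectralDomain] 0, α < min α₁ α₂ :=
      (eventually_lt_nhds (lt_min hα₁ hα₂)).filter_mono nhdsWithin_le_nhds
    filter_upwards [self_mem_nhdsWithin, hlt] with α hα hα'
    have h3 := h1 α hα (hα'.trans_le (min_le_left _ _))
    have h4 := h2 α hα (hα'.trans_le (min_le_right _ _))
    rw [Real.norm_eq_abs, Real.norm_eq_abs, abs_of_pos hα.1, abs_le]
    unfold DGLDPC.Params.expansion at h3 h4
    constructor <;> linarith
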